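/- **Conventions.** Manifolds are smooth, finite-dimensional, without boundary, Hausdorff and second countable. Let $(\bar M,\varphi,g)$ be a Kähler manifold, that is, $g$ is a smooth Riemannian metric and $\varphi$ a smooth $(1,1)$-tensor field on $\bar M$ with $\varphi^2=-I$, $g(\varphi\cdot,\varphi\cdot)=g$ and $\bar\nabla\varphi=0$, where $\bar\nabla$ is the Levi-Civita connection of $g$. Let $M$ be a submanifold of $\bar M$ defined by an injective immersion, with the induced metric (also denoted $g$) and its Levi-Civita connection $\nabla$. For $X,Y\in\Gamma(TM)$ and $V\in\Gamma(T^{\perp}M)$, let $TX$ and $NX$ be the tangential and the normal component of $\varphi X$, let $h(X,Y)$ be the normal component of $\bar\nabla_XY$ (the second fundamental form), and let $-A_VX$ be the tangential component of $\bar\nabla_XV$ (so $A$ is the shape operator). $M$ is a *pointwise $k$-slant submanifold* ($k\ge 1$) if there are pairwise orthogonal smooth regular distributions $\mathcal D_0,\mathcal D_1,\dots,\mathcal D_k$ on $M$ such that * $TM=\mathcal D_0\oplus\mathcal D_1\oplus\dots\oplus\mathcal D_k$ and $T(\mathcal D_i)\subseteq\mathcal D_i$ for $i\in\{1,\dots,k\}$;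 * $\mathcal D_0$ is invariant, i.e. $\varphi(\mathcal D_0)\subseteq\mathcal D_0$ (it may be trivial); * for $i\in\{1,\dots,k\}$, $\mathcal D_i$ is nontrivial and pointwise slant: for every $p\in M$ the angle between $\varphi X_p$ and $(\mathcal D_i)_p$ has the same value $\theta_i(p)\in(0,\frac{\pi}{2}]$ for all nonzero $X_p\in(\mathcal D_i)_p$; and $\theta_i(p)\neq\theta_j(p)$ for all $p\in M$ and $i\neq j$ in $\{1,\dots,k\}$. Put $\theta_0:=0$. A distribution $\mathcal D$ on $M$ is *integrable* if $[X,Y]\in\Gamma(\mathcal D)$ for all $X,Y\in\Gamma(\mathcal D)$. **Theorem.** Let $M$ be a pointwise $k$-slant submanifold of a Kähler manifold $(\bar M,\varphi,g)$, with distributions $\mathcal D_0,\dots,\mathcal D_k$ and slant functions $\theta_0,\dots,\theta_k$ as above. Then: (i) for each $i\in\{0,\dots,k\}$, $\mathcal D_i$ is integrable if and only if $$g(X,\nabla_YZ)=g(Y,\nabla_XZ)$$ for all $X,Y\in\Gamma(\mathcal D_i)$, all $j\in\{0,\dots,k\}$ with $j\neq i$ and all $Z\in\Gamma(\mathcal D_j)$;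 (ii) $\mathcal D_0$ is integrable if and only if $h(X,TY)=h(TX,Y)$ for all $X,Y\in\Gamma(\mathcal D_0)$; (iii) for each $i\in\{0,\dots,k\}$ such that $\theta_j(p)\neq\frac{\pi}{2}$ for all $p\in M$ and all $j\in\{0,\dots,k\}$ with $j\neq i$, $\mathcal D_i$ is integrable if and only if $$\nabla_XTY-\nabla_YTX+A_{NX}Y-A_{NY}X\in\Gamma(\mathcal D_i)$$ for all $X,Y\in\Gamma(\mathcal D_i)$. -/

import Mathlib

open Bundle VectorField
open scoped Manifold ContDiff Bundle Topology

namespace KSlant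

section LeviCivita

/-- The tangent space at the point `x` of a manifold modelled on `E`. -/
abbrev Tan (E : Type*) {M : Type*} [NormedAddCommGroup E] [NormedSpace ℝ E] [TopologicalSpace M]
    [ChartedSpace E M] (x : M) : Type _ :=
  TangentSpace 𝓘(ℝ, E) x

/-- (Not necessarily continuous) vector fields on `M`. -/
abbrev VField (E M : Type*) [NormedAddCommGroup E] [NormedSpace ℝ E] [TopologicalSpace M]
    [ChartedSpace E M] : Type _ :=
  Π x : M, TangentSpace 𝓘(ℝ, E) x

/-- Smooth Riemannian metrics on the manifold `M`. -/
abbrev RiemMetric (E M : Type*) [NormedAddCommGroup E] [NormedSpace ℝ E] [TopologicalSpace M]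
    [ChartedSpace E M] [IsManifold 𝓘(ℝ, E) ∞ M] : Type _ :=
  ContMDiffRiemannianMetric 𝓘(ℝ, E) ∞ E (fun x : M ↦ TangentSpace 𝓘(ℝ, E) x)

/-- Affine connections on `M`; for a connection `cov`, the vector `(∇_v Y)_x` is `cov Y x v`. -/
abbrev Connection (E M : Type*) [NormedAddCommGroup E] [NormedSpace ℝ E] [TopologicalSpace M]
    [ChartedSpace E M] [IsManifold 𝓘(ℝ, E) ∞ M] : Type _ :=
  CovariantDerivative 𝓘(ℝ, E) E (fun x : M ↦ TangentSpace 𝓘(ℝ, E) x)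

variable {E : Type*} [NormedAddCommGroup E] [NormedSpace ℝ E]
  {M : Type*} [TopologicalSpace M] [ChartedSpace E M] [IsManifold 𝓘(ℝ, E) ∞ M]

theorem RiemMetric.mdifferentiableAt (g : RiemMetric E M) {X Y : VField E M} {x : M}
    (hX : MDiffAt (T% X) x) (hY : MDiffAt (T% Y) x) :
    MDiffAt (fun y ↦ g.inner y (X y) (Y y)) x := by
  let : RiemannianBundle (fun x : M ↦ Tan E x) := ⟨g.toRiemannianMetric⟩
  exact MDifferentiableAt.inner_bundle (IB := 𝓘(ℝ, E)) (F := E)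
    (E := fun x : M ↦ Tan E x) (b := id) hX hY

theorem RiemMetric.ext_inner (g : RiemMetric E M) {x : M} {v v' : Tan E x}
    (h : ∀ w, g.inner x v w = g.inner x v' w) : v = v' := by
  by_contra hne
  have h1 := g.pos x (v - v') (sub_ne_zero.2 hne)
  have h2 := h (v - v')
  simp [h2] at h1

theorem RiemMetric.ext_clm (g : RiemMetric E M) {x : M}
    {A B : Tan E x →L[ℝ] Tan E x}
    (h : ∀ X Z : VField E M, MDiffAt (T% X) x → MDiffAt (T% Z) x →
      g.inner x (A (X x)) (Z x) = g.inner x (B (X x)) (Z x)) : A = B := by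
  ext v
  refine g.ext_inner fun w ↦ ?_
  have := h (FiberBundle.extend E v) (FiberBundle.extend E w)
    (FiberBundle.mdifferentiableAt_extend ..) (FiberBundle.mdifferentiableAt_extend ..)
  simpa using this

variable [FiniteDimensional ℝ E]

instance (x : M) : FiniteDimensional ℝ (Tan E x) :=
  inferInstanceAs (FiniteDimensional ℝ E)

instance (x : M) : T2Space (Tan E x) :=
  inferInstanceAs (T2Space E)

/-- The musical isomorphism `v ↦ g(v, ·)` from `T_x M` onto its dual. -/
noncomputable def RiemMetric.flat (g : RiemMetric E M) (x : M) :
    Tan E x ≃ₗ[ℝ] Module.Dual ℝ (Tan E x) :=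
  LinearEquiv.ofInjectiveOfFinrankEq (ContinuousLinearMap.coeLM ℝ ∘ₗ (g.inner x).toLinearMap)
    (fun _ _ h ↦ g.ext_inner fun w ↦ congr($h w)) Subspace.dual_finrank_eq.symm

theorem RiemMetric.flat_apply (g : RiemMetric E M) (x : M) (v w : Tan E x) :
    g.flat x v w = g.inner x v w := rfl

theorem RiemMetric.inner_flat_symm (g : RiemMetric E M) (x : M)
    (l : Module.Dual ℝ (Tan E x)) (w : Tan E x) :
    g.inner x ((g.flat x).symm l) w = l w := by
  rw [← g.flat_apply, LinearEquiv.apply_symm_apply]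

/-- The two defining properties of the Levi-Civita connection of `g`: it is torsion-free,
`∇_X Y - ∇_Y X = [X, Y]`, and metric, `v (g(X, Y)) = g(∇_v X, Y) + g(X, ∇_v Y)`. -/
structure IsLeviCivita (g : RiemMetric E M)
    (cov : Connection E M) : Prop where
  torsion_free : ∀ {X Y : VField E M} {x : M},
    MDiffAt (T% X) x → MDiffAt (T% Y) x →
      cov Y x (X x) - cov X x (Y x) = mlieBracket 𝓘(ℝ, E) X Y x
  metric : ∀ {X Y : VField E M} {x : M} (v : Tan E x),
    MDiffAt (T% X) x → MDiffAt (T% Y) x →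
      mvfderiv 𝓘(ℝ, E) (fun y ↦ g.inner y (X y) (Y y)) x v
        = g.inner x (cov X x v) (Y x) + g.inner x (X x) (cov Y x v)

/-- The Koszul expression, which will be `g(∇_X Y, Z)` for the Levi-Civita connection `∇`. -/
noncomputable def koszul (g : RiemMetric E M) (X Y Z : VField E M) (x : M) : ℝ :=
  (1 / 2) * (mvfderiv 𝓘(ℝ, E) (fun y ↦ g.inner y (Y y) (Z y)) x (X x)
  + mvfderiv 𝓘(ℝ, E) (fun y ↦ g.inner y (X y) (Z y)) x (Y x)
  - mvfderiv 𝓘(ℝ, E) (fun y ↦ g.inner y (X y) (Y y)) x (Z x)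
  + g.inner x (mlieBracket 𝓘(ℝ, E) X Y x) (Z x)
  - g.inner x (mlieBracket 𝓘(ℝ, E) X Z x) (Y x)
  - g.inner x (mlieBracket 𝓘(ℝ, E) Y Z x) (X x))

theorem koszul_tensorial_right (g : RiemMetric E M) {X Y : VField E M} {x : M}
    (hX : MDiffAt (T% X) x) (hY : MDiffAt (T% Y) x) :
    TensorialAt 𝓘(ℝ, E) E (koszul g X Y · x) x where
  smul hf hs := by
    simp [koszul, mvfderiv_fun_mul hf (g.mdifferentiableAt hX hs),
      mvfderiv_fun_mul hf (g.mdifferentiableAt hY hs), mlieBracket_smul_right hf hs]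
    rw [g.symm x _ (Y x), g.symm x _ (X x), g.symm x _ (X x)]
    ring
  add hs hs' := by
    simp [koszul, mvfderiv_fun_add (g.mdifferentiableAt hX hs) (g.mdifferentiableAt hX hs'),
      mvfderiv_fun_add (g.mdifferentiableAt hY hs) (g.mdifferentiableAt hY hs'),
      mlieBracket_add_right hs hs']
    ring

theorem koszul_tensorial_left (g : RiemMetric E M) {Y Z : VField E M} {x : M}
    (hY : MDiffAt (T% Y) x) (hZ : MDiffAt (T% Z) x) :
    TensorialAt 𝓘(ℝ, E) E (koszul g · Y Z x) x where
  smul hf hs := by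
    simp [koszul, mvfderiv_fun_mul hf (g.mdifferentiableAt hs hZ),
      mvfderiv_fun_mul hf (g.mdifferentiableAt hs hY), mlieBracket_smul_left hf hs]
    rw [g.symm x _ (Y x)]
    ring
  add hs hs' := by
    simp [koszul, mvfderiv_fun_add (g.mdifferentiableAt hs hZ) (g.mdifferentiableAt hs' hZ),
      mvfderiv_fun_add (g.mdifferentiableAt hs hY) (g.mdifferentiableAt hs' hY),
      mlieBracket_add_left hs hs']
    ring

open Classical in
/-- The covariant derivative `v ↦ ∇_v Y` at `x` given by the Koszul formula, for `Y` differentiable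
at `x` (and the junk value `0` otherwise). -/
noncomputable def leviCivitaFun (g : RiemMetric E M) (Y : VField E M) (x : M) :
    Tan E x →L[ℝ] Tan E x :=
  if hY : MDiffAt (T% Y) x then
    LinearMap.toContinuousLinearMap ((g.flat x).symm.toLinearMap ∘ₗ ContinuousLinearMap.coeLM ℝ ∘ₗ
      (TensorialAt.mkHom₂ (I := 𝓘(ℝ, E)) (F := E) (F' := E) (fun X Z ↦ koszul g X Y Z x) x
        (fun _ h ↦ koszul_tensorial_left g hY h)
        (fun _ h ↦ koszul_tensorial_right g h hY)).toLinearMap)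
  else 0

theorem inner_leviCivitaFun (g : RiemMetric E M) {X Y Z : VField E M} {x : M}
    (hX : MDiffAt (T% X) x) (hY : MDiffAt (T% Y) x) (hZ : MDiffAt (T% Z) x) :
    g.inner x (leviCivitaFun g Y x (X x)) (Z x) = koszul g X Y Z x := by
  rw [leviCivitaFun, dif_pos hY]
  simp only [LinearMap.coe_toContinuousLinearMap', LinearMap.comp_apply, LinearEquiv.coe_coe]
  rw [g.inner_flat_symm]
  exact TensorialAt.mkHom₂_apply (I := 𝓘(ℝ, E)) (F := E) (F' := E)
    (Φ := fun X Z ↦ koszul g X Y Z x) (fun _ h ↦ koszul_tensorial_left g hY h)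
    (fun _ h ↦ koszul_tensorial_right g h hY) hX hZ

/-- The Levi-Civita connection of `g`, built from the Koszul formula. -/
noncomputable def leviCivita (g : RiemMetric E M) :
    Connection E M where
  toFun := leviCivitaFun g
  isCovariantDerivativeOnUniv :=
    { add := by
        intro Y Y' x hY hY' _
        refine g.ext_clm fun X Z hX hZ ↦ ?_
        simp only [add_apply, map_add]
        rw [inner_leviCivitaFun g hX (mdifferentiableAt_add_section hY hY') hZ,
          inner_leviCivitaFun g hX hY hZ, inner_leviCivitaFun g hX hY' hZ]
        simp [koszul, mvfderiv_fun_add (g.mdifferentiableAt hY hZ) (g.mdifferentiableAt hY' hZ),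
          mvfderiv_fun_add (g.mdifferentiableAt hX hY) (g.mdifferentiableAt hX hY'),
          mlieBracket_add_left hY hY', mlieBracket_add_right hY hY']
        ring
      leibniz := by
        intro Y f x hY hf _
        refine g.ext_clm fun X Z hX hZ ↦ ?_
        simp only [add_apply, map_add, smul_apply, map_smul,
          ContinuousLinearMap.smulRight_apply]
        rw [inner_leviCivitaFun g hX (hf.smul_section hY) hZ, inner_leviCivitaFun g hX hY hZ]
        simp [koszul, mvfderiv_fun_mul hf (g.mdifferentiableAt hY hZ),
          mvfderiv_fun_mul hf (g.mdifferentiableAt hX hY),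
          mlieBracket_smul_left hf hY, mlieBracket_smul_right hf hY]
        rw [g.symm x (X x) (Y x)]
        ring }

theorem isLeviCivita_leviCivita (g : RiemMetric E M) : IsLeviCivita g (leviCivita g) where
  torsion_free := by
    intro X Y x hX hY
    refine g.ext_inner fun w ↦ ?_
    have hw := FiberBundle.mdifferentiableAt_extend (F := E) 𝓘(ℝ, E) w
    have h1 := inner_leviCivitaFun g hX hY hw
    have h2 := inner_leviCivitaFun g hY hX hw
    simp only [FiberBundle.extend_apply_self] at h1 h2
    simp only [map_sub, sub_apply]
    change g.inner x (leviCivitaFun g Y x (X x)) w - g.inner x (leviCivitaFun g X x (Y x)) w = _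
    rw [h1, h2]
    have h3 : (fun y ↦ g.inner y (Y y) (X y)) = fun y ↦ g.inner y (X y) (Y y) := by
      ext y; exact g.symm ..
    simp [koszul, h3, mlieBracket_swap_apply (V := Y) (W := X)]
    ring
  metric := by
    intro X Y x v hX hY
    have hv := FiberBundle.mdifferentiableAt_extend (F := E) 𝓘(ℝ, E) v
    have h1 := inner_leviCivitaFun g hv hX hY
    have h2 := inner_leviCivitaFun g hv hY hX
    simp only [FiberBundle.extend_apply_self] at h1 h2
    change _ = g.inner x (leviCivitaFun g X x v) (Y x) + g.inner x (X x) (leviCivitaFun g Y x v)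
    rw [g.symm x (X x), h1, h2]
    have h3 : (fun y ↦ g.inner y (Y y) (X y)) = fun y ↦ g.inner y (X y) (Y y) := by
      ext y; exact g.symm ..
    simp [koszul, h3, mlieBracket_swap_apply (V := Y) (W := X)]
    ring
end LeviCivita

set_option linter.unusedSectionVars false

section Submanifold

variable {E F : Type*} [NormedAddCommGroup E] [NormedSpace ℝ E] [FiniteDimensional ℝ E]
  [NormedAddCommGroup F] [NormedSpace ℝ F] [FiniteDimensional ℝ F]
  {M N : Type*} [TopologicalSpace M] [ChartedSpace E M] [IsManifold 𝓘(ℝ, E) ∞ M]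
  [TopologicalSpace N] [ChartedSpace F N] [IsManifold 𝓘(ℝ, F) ∞ N]

/-- The connection induced by `cov` along `f : M → N`, i.e. the pullback connection on `f^*TN`:
for a vector field `s` along `f`, the vector `∇_v s` at `f p` is `alongDeriv cov f s p v`.
In the local trivialization of `TN` at `f p`, it is the derivative of the components of `s` in the
direction `v`, plus the derivative in the direction `df v` of the field on `N` with the (constant)
components of `s p`. By `alongDeriv_comp` below it restricts to the usual
`∇_{df v} σ` on the fields `s = σ ∘ f`. -/
noncomputable def alongDeriv
    (cov : Connection F N) (f : M → N)
    (s : Π p : M, Tan F (f p)) (p : M) :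
    Tan E p →L[ℝ] Tan F (f p) :=
  ((trivializationAt F (TangentSpace 𝓘(ℝ, F)) (f p)).symmL ℝ (f p)).comp
      (mvfderiv 𝓘(ℝ, E)
        (fun q ↦ (trivializationAt F (TangentSpace 𝓘(ℝ, F)) (f p) ⟨f q, s q⟩).2) p)
    + (cov (FiberBundle.extend F (s p)) (f p)).comp (mfderiv 𝓘(ℝ, E) 𝓘(ℝ, F) f p)


theorem cov_sum {ι : Type*}
    (cov : Connection F N)
    (a : ι → N → ℝ) (e : ι → VField F N) {y : N}
    (ha : ∀ i, MDiffAt (a i) y) (he : ∀ i, MDiffAt (T% (e i)) y) (s : Finset ι) :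
    cov (fun z ↦ ∑ i ∈ s, a i z • e i z) y =
      ∑ i ∈ s, (a i y • cov (e i) y + (mvfderiv 𝓘(ℝ, F) (a i) y).smulRight (e i y)) := by
  classical
  induction s using Finset.induction_on with
  | empty => exact congr($cov.zero y)
  | insert i s hi ih =>
    simp only [Finset.sum_insert hi, ← ih]
    rw [← cov.isCovariantDerivativeOnUniv.leibniz (he i) (ha i)]
    exact cov.isCovariantDerivativeOnUniv.add ((ha i).smul_section (he i))
      (.sum_section fun i _ ↦ (ha i).smul_section (he i))

theorem cov_eq_extend (cov : Connection F N)
    {σ : VField F N} {y : N} (hσ : MDiffAt (T% σ) y) :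
    cov σ y = ((trivializationAt F (TangentSpace 𝓘(ℝ, F)) y).symmL ℝ y).comp
      (mvfderiv 𝓘(ℝ, F) (fun z ↦ (trivializationAt F (TangentSpace 𝓘(ℝ, F)) y ⟨z, σ z⟩).2) y)
      + cov (FiberBundle.extend F (σ y)) y := by
  let t := trivializationAt F (TangentSpace 𝓘(ℝ, F)) y
  have y_mem : y ∈ t.baseSet := FiberBundle.mem_baseSet_trivializationAt F _ y
  let b := Module.finBasis ℝ F
  let e : _ → VField F N := fun i z ↦ t.symmL ℝ z (b i)
  let u : N → F := fun z ↦ (t ⟨z, σ z⟩).2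
  let c := fun i ↦ LinearMap.toContinuousLinearMap (b.coord i)
  have hu : MDiffAt u y := (mdifferentiableAt_section 𝓘(ℝ, F) σ).1 hσ
  let a : _ → N → ℝ := fun i z ↦ c i (u z)
  have ha' : ∀ i, mvfderiv 𝓘(ℝ, F) (a i) y = (c i).comp (mvfderiv 𝓘(ℝ, F) u y) := fun i ↦ by
    have := ((c i).hasFDerivAt (x := u y)).hasMFDerivAt.comp y hu.hasMFDerivAt
    exact this.mfderiv
  have ha : ∀ i, MDiffAt (a i) y := fun i ↦
    ((c i).hasFDerivAt (x := u y)).hasMFDerivAt.mdifferentiableAt.comp y hu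
  have he : ∀ i, MDiffAt (T% (e i)) y := fun i ↦ by
    rw [mdifferentiableAt_section]
    refine (mdifferentiableAt_const (c := b i)).congr_of_eventuallyEq ?_
    filter_upwards [t.open_baseSet.mem_nhds y_mem] with z hz
    change (t ⟨z, t.symmL ℝ z (b i)⟩).2 = b i
    rw [t.symmL_apply hz, t.apply_mk_symm hz]
  have key : ∀ (w : F) (z : N), ∑ i, c i w • e i z = t.symmL ℝ z w := fun w z ↦ by
    conv_rhs => rw [← b.sum_repr w]
    rw [map_sum (t.symmL ℝ z)]
    simp [e, c]
  have h1 : cov σ y = cov (fun z ↦ ∑ i, a i z • e i z) y := by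
    refine cov.isCovariantDerivativeOnUniv.congr_of_eventuallyEq hσ
      (.sum_section fun i _ ↦ (ha i).smul_section (he i)) Filter.univ_mem ?_
    filter_upwards [t.open_baseSet.mem_nhds y_mem] with z hz
    simp only [a]
    rw [key]
    simp [u, hz]
  have h2 : cov (FiberBundle.extend F (σ y)) y = cov (fun z ↦ ∑ i, a i y • e i z) y := by
    refine cov.isCovariantDerivativeOnUniv.congr_of_eventuallyEq
      (FiberBundle.mdifferentiableAt_extend ..)
      (.sum_section fun i _ ↦ mdifferentiableAt_const.smul_section (he i)) Filter.univ_mem ?_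
    filter_upwards [t.open_baseSet.mem_nhds y_mem] with z hz
    simp only [a]
    rw [key, t.symmL_apply hz]
    rfl
  rw [h1, h2, cov_sum cov a e ha he, cov_sum cov (fun i _ ↦ a i y) e
    (fun i ↦ mdifferentiableAt_const) he]
  ext v
  have h3 : ∀ i, mvfderiv 𝓘(ℝ, F) (fun _ : N ↦ a i y) y = 0 := fun i ↦ mvfderiv_const ..
  simp only [ha', h3, Finset.sum_add_distrib, add_apply, sum_apply]
  simp
  rw [add_comm]
  congr 1
  exact key _ _

theorem alongDeriv_comp
    (cov : Connection F N) {f : M → N}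
    {σ : VField F N} {p : M}
    (hf : MDifferentiableAt 𝓘(ℝ, E) 𝓘(ℝ, F) f p) (hσ : MDiffAt (T% σ) (f p)) :
    alongDeriv cov f (fun q ↦ σ (f q)) p =
      (cov σ (f p)).comp (mfderiv 𝓘(ℝ, E) 𝓘(ℝ, F) f p) := by
  rw [cov_eq_extend cov hσ, alongDeriv, ContinuousLinearMap.add_comp]
  congr 1
  have hu := (mdifferentiableAt_section 𝓘(ℝ, F) σ).1 hσ
  exact congr(ContinuousLinearMap.comp _ $((hu.hasMFDerivAt.comp p hf.hasMFDerivAt).mfderiv))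


/-- `f : M → N` is an injective immersion which makes `M` a submanifold of the Riemannian manifold
`(N, g)`, and `gM` is the induced metric. -/
structure IsSubmanifold (gM : RiemMetric E M) (g : RiemMetric F N) (f : M → N) : Prop where
  smooth : ContMDiff 𝓘(ℝ, E) 𝓘(ℝ, F) ∞ f
  injective : Function.Injective f
  immersion : ∀ p, Function.Injective (mfderiv 𝓘(ℝ, E) 𝓘(ℝ, F) f p)
  induced : ∀ (p : M) (v w : Tan E p), gM.inner p v w =
    g.inner (f p) (mfderiv 𝓘(ℝ, E) 𝓘(ℝ, F) f p v) (mfderiv 𝓘(ℝ, E) 𝓘(ℝ, F) f p w)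

/-- `(N, φ, g)` is almost Hermitian. -/
structure IsAlmostHermitian (g : RiemMetric F N) (φ : Π y : N, Tan F y →L[ℝ] Tan F y) : Prop where
  smooth : ContMDiff 𝓘(ℝ, F) (𝓘(ℝ, F).prod 𝓘(ℝ, F →L[ℝ] F)) ∞
    (fun y ↦ TotalSpace.mk' (F →L[ℝ] F)
      (E := fun y : N ↦ TangentSpace 𝓘(ℝ, F) y →L[ℝ] TangentSpace 𝓘(ℝ, F) y) y (φ y))
  sq : ∀ (y : N) (v : Tan F y), φ y (φ y v) = -v
  isometry : ∀ (y : N) (v w : Tan F y), g.inner y (φ y v) (φ y w) = g.inner y v w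

/-- `(N, φ, g)` is Kähler: it is almost Hermitian and `(∇_v φ) Y = ∇_v (φ Y) - φ (∇_v Y)` vanishes
for the Levi-Civita connection `∇` of `g`. -/
structure IsKahler (g : RiemMetric F N) (φ : Π y : N, Tan F y →L[ℝ] Tan F y) : Prop
    extends IsAlmostHermitian g φ where
  parallel : ∀ (Y : VField F N) (y : N), MDiffAt (T% Y) y → ∀ v : Tan F y,
    leviCivita g (fun z ↦ φ z (Y z)) y v = φ y (leviCivita g Y y v)

/-- The tangential component of `w ∈ T_{f p} N`, as an element of `T_p M`: the vector `v` with
`gM(v, u) = g(w, df u)` for all `u ∈ T_p M`. -/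
noncomputable def tangentPart (gM : RiemMetric E M) (g : RiemMetric F N) (f : M → N) (p : M)
    (w : Tan F (f p)) : Tan E p :=
  (gM.flat p).symm ((g.inner (f p) w).comp (mfderiv 𝓘(ℝ, E) 𝓘(ℝ, F) f p)).toLinearMap

/-- The normal component of `w ∈ T_{f p} N`. -/
noncomputable def normalPart (gM : RiemMetric E M) (g : RiemMetric F N) (f : M → N) (p : M)
    (w : Tan F (f p)) : Tan F (f p) :=
  w - mfderiv 𝓘(ℝ, E) 𝓘(ℝ, F) f p (tangentPart gM g f p w)

/-- The normal component is indeed orthogonal to the submanifold. -/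
theorem inner_normalPart {gM : RiemMetric E M} {g : RiemMetric F N} {f : M → N}
    (hf : IsSubmanifold gM g f) (p : M) (w : Tan F (f p)) (u : Tan E p) :
    g.inner (f p) (normalPart gM g f p w) (mfderiv 𝓘(ℝ, E) 𝓘(ℝ, F) f p u) = 0 := by
  rw [normalPart, map_sub, sub_apply, ← hf.induced, tangentPart, gM.inner_flat_symm]
  exact sub_self _

/-- The vector field `Y` on `M`, regarded as a vector field along `f : M → N`. -/
noncomputable def pushField (f : M → N) (Y : VField E M) (p : M) : Tan F (f p) :=
  mfderiv 𝓘(ℝ, E) 𝓘(ℝ, F) f p (Y p)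

/-- `TX`, the tangential component of `φ X`. -/
noncomputable def opT (gM : RiemMetric E M) (g : RiemMetric F N)
    (φ : Π y : N, Tan F y →L[ℝ] Tan F y) (f : M → N) (X : VField E M) : VField E M :=
  fun p ↦ tangentPart gM g f p (φ (f p) (pushField f X p))

/-- `NX`, the normal component of `φ X`. -/
noncomputable def opN (gM : RiemMetric E M) (g : RiemMetric F N)
    (φ : Π y : N, Tan F y →L[ℝ] Tan F y) (f : M → N) (X : VField E M) (p : M) : Tan F (f p) :=
  normalPart gM g f p (φ (f p) (pushField f X p))

/-- The second fundamental form `h(X, Y)`: the normal component of the ambient derivative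
of `Y` in the direction `X`. -/
noncomputable def secondFundamentalForm (gM : RiemMetric E M) (g : RiemMetric F N) (f : M → N)
    (X Y : VField E M) (p : M) : Tan F (f p) :=
  normalPart gM g f p (alongDeriv (leviCivita g) f (pushField f Y) p (X p))

/-- The shape operator `A_V X` for a normal vector field `V` along `f`: minus the tangential
component of the ambient derivative of `V` in the direction `X`. -/
noncomputable def shapeOperator (gM : RiemMetric E M) (g : RiemMetric F N) (f : M → N)
    (V : Π p : M, Tan F (f p)) (X : VField E M) : VField E M :=
  fun p ↦ -tangentPart gM g f p (alongDeriv (leviCivita g) f V p (X p))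

/-- The angle between a nonzero vector `w` and a nonzero subspace `K` of `T_y N`: the smallest angle
between `w` and a nonzero vector of `K`. -/
noncomputable def angleToSubspace (g : RiemMetric F N) (y : N) (w : Tan F y)
    (K : Submodule ℝ (Tan F y)) : ℝ :=
  sInf {α | ∃ u ∈ K, u ≠ 0 ∧
    α = Real.arccos (g.inner y w u / (√(g.inner y w w) * √(g.inner y u u)))}

/-- The family `D` of subspaces of the tangent spaces is a smooth regular distribution: locally it
has a frame consisting of smooth vector fields. -/
def IsSmoothDistribution (D : Π p : M, Submodule ℝ (Tan E p)) : Prop :=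
  ∀ p : M, ∃ U : Set M, IsOpen U ∧ p ∈ U ∧ ∃ (r : ℕ) (X : Fin r → VField E M),
    (∀ a, CMDiff[U] ∞ (T% (X a))) ∧
    ∀ q ∈ U, LinearIndependent ℝ (fun a ↦ X a q) ∧
      Submodule.span ℝ (Set.range fun a ↦ X a q) = D q

/-- `X ∈ Γ(D)`: the vector field `X` is smooth, with values in `D`. -/
def IsSection (D : Π p : M, Submodule ℝ (Tan E p)) (X : VField E M) : Prop :=
  CMDiff ∞ (T% X) ∧ ∀ p, X p ∈ D p

/-- `D` is integrable: `[X, Y] ∈ Γ(D)` for all `X, Y ∈ Γ(D)`. -/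
def IsIntegrable (D : Π p : M, Submodule ℝ (Tan E p)) : Prop :=
  ∀ X Y : VField E M, IsSection D X → IsSection D Y → IsSection D (mlieBracket 𝓘(ℝ, E) X Y)

/-- `D` is a pointwise slant distribution with slant function `θ`: at each point `p`, the angle
between `φ v` and `D_p` is `θ p ∈ (0, π/2]` for every nonzero `v ∈ D_p`. -/
def IsPointwiseSlantDistribution (g : RiemMetric F N) (φ : Π y : N, Tan F y →L[ℝ] Tan F y)
    (f : M → N) (D : Π p : M, Submodule ℝ (Tan E p)) (θ : M → ℝ) : Prop :=
  ∀ p, θ p ∈ Set.Ioc 0 (Real.pi / 2) ∧ ∀ v ∈ D p, v ≠ 0 →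
    angleToSubspace g (f p) (φ (f p) (mfderiv 𝓘(ℝ, E) 𝓘(ℝ, F) f p v))
      ((D p).map (mfderiv 𝓘(ℝ, E) 𝓘(ℝ, F) f p).toLinearMap) = θ p

/-- `M` is a pointwise `k`-slant submanifold of the almost Hermitian manifold `(N, φ, g)`, with
component distributions `D 0, …, D k` and slant functions `θ 0, …, θ k`, where `θ 0 = 0` by
convention. (As the `D i` are orthogonal, their sum is automatically direct.) -/
structure IsPointwiseSlant (gM : RiemMetric E M) (g : RiemMetric F N)
    (φ : Π y : N, Tan F y →L[ℝ] Tan F y) (f : M → N) (k : ℕ)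
    (D : Fin (k + 1) → Π p : M, Submodule ℝ (Tan E p)) (θ : Fin (k + 1) → M → ℝ) : Prop
    extends IsSubmanifold gM g f where
  one_le : 1 ≤ k
  smooth_distribution : ∀ i, IsSmoothDistribution (D i)
  orthogonal : ∀ i j, i ≠ j → ∀ p, ∀ v ∈ D i p, ∀ w ∈ D j p, gM.inner p v w = 0
  sum_eq_top : ∀ p, ⨆ i, D i p = ⊤
  tangent_invariant : ∀ i, i ≠ 0 → ∀ p, ∀ v ∈ D i p,
    tangentPart gM g f p (φ (f p) (mfderiv 𝓘(ℝ, E) 𝓘(ℝ, F) f p v)) ∈ D i p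
  invariant : ∀ p, ∀ v ∈ D 0 p, ∃ w ∈ D 0 p,
    φ (f p) (mfderiv 𝓘(ℝ, E) 𝓘(ℝ, F) f p v) = mfderiv 𝓘(ℝ, E) 𝓘(ℝ, F) f p w
  nontrivial : ∀ i, i ≠ 0 → ∀ p, D i p ≠ ⊥
  slant : ∀ i, i ≠ 0 → IsPointwiseSlantDistribution g φ f (D i) (θ i)
  slant_zero : ∀ p, θ 0 p = 0
  slant_distinct : ∀ i j, i ≠ 0 → j ≠ 0 → i ≠ j → ∀ p, θ i p ≠ θ j p

end Submanifold

end KSlant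

/-!
# Integrability of the component distributions of a pointwise slant submanifold

Each of the three conditions controls the bracket `[X, Y]` of two sections of `D i` through a
pointwise linear condition which cuts out `D i`.

* `D i` is the orthogonal complement of the sum of the other `D j`
  (`IsPointwiseSlant.mem_of_orthogonal`), and for `Z` a section of `D j` one has
  `g([X, Y], Z) = g(X, ∇_Y Z) - g(Y, ∇_X Z)` (`inner_mlieBracket`). To pass from fields `Z` to
  vectors, every vector of `D j` is extended to a global section (`exists_isSection_apply_eq`).
* `D 0` is the kernel of the normal part `N` of `φ`
  (`IsPointwiseSlant.normalPart_almostComplex_eq_zero_iff`), and for sections of `D 0` one has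
  `h(X, TY) - h(TX, Y) = N[X, Y]` (`secondFundamentalForm_opT_sub`).
* If no other `θ j` takes the value `π / 2`, then `T v ∈ D i` if and only if `v ∈ D i`
  (`IsPointwiseSlant.tangentEnd_mem_iff`), and
  `∇_X TY - ∇_Y TX + A_{NX} Y - A_{NY} X = T[X, Y]` (`leviCivita_opT_sub_add_shapeOperator`).

The last two identities are the normal and the tangential part of
`∇'_X (φ Y) - ∇'_Y (φ X) = φ (∇'_X Y - ∇'_Y X) = φ [X, Y]`, where `∇'` is the connection along `f`
induced by the ambient Levi-Civita connection. This rests on three properties of `∇'`: it is metric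
(`mvfderiv_inner_along`), torsion-free (`alongDeriv_pushField_sub`) and it commutes with `φ`
(`alongDeriv_almostComplex`). The first and the last are reduced to fields on `N` by
`MDiffAlongAt.induction`. For the torsion no extension of fields to `N` is needed: in a chart of `N`
it is the fact that `[X, Y]` is the commutator of the derivations `X` and `Y`, applied to the vector
valued function which `f` becomes in the chart (`mvfderiv_mlieBracket`). The Gauss formula
(`tangentPart_alongDeriv_pushField`) follows, since the tangential part of `∇'` satisfies the Koszul
formula of the induced metric.
-/

namespace KSlant

set_option linter.unusedSectionVars false

/-! ### Vector fields along a map -/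

section Along

variable {E F : Type*} [NormedAddCommGroup E] [NormedSpace ℝ E] [FiniteDimensional ℝ E]
  [NormedAddCommGroup F] [NormedSpace ℝ F] [FiniteDimensional ℝ F]
  {M N : Type*} [TopologicalSpace M] [ChartedSpace E M] [IsManifold 𝓘(ℝ, E) ∞ M]
  [TopologicalSpace N] [ChartedSpace F N] [IsManifold 𝓘(ℝ, F) ∞ N]

/-- The vector field `s` along `f : M → N` is differentiable at `p`, as a map from `M` to the
tangent bundle of `N`. -/
def MDiffAlongAt (E : Type*) {F : Type*} [NormedAddCommGroup E] [NormedSpace ℝ E]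
    [NormedAddCommGroup F] [NormedSpace ℝ F] {M N : Type*} [TopologicalSpace M] [ChartedSpace E M]
    [TopologicalSpace N] [ChartedSpace F N] [IsManifold 𝓘(ℝ, F) ∞ N]
    (f : M → N) (s : Π p : M, Tan F (f p)) (p : M) : Prop :=
  MDifferentiableAt 𝓘(ℝ, E) (𝓘(ℝ, F).prod 𝓘(ℝ, F))
    (fun q ↦ TotalSpace.mk' F (E := TangentSpace 𝓘(ℝ, F)) (f q) (s q)) p

variable {f : M → N} {s s' : Π p : M, Tan F (f p)} {p : M}

theorem mdiffAlongAt_iff : MDiffAlongAt E f s p ↔ MDifferentiableAt 𝓘(ℝ, E) 𝓘(ℝ, F) f p ∧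
    MDifferentiableAt 𝓘(ℝ, E) 𝓘(ℝ, F)
      (fun q ↦ (trivializationAt F (TangentSpace 𝓘(ℝ, F)) (f p) ⟨f q, s q⟩).2) p :=
  mdifferentiableAt_totalSpace ..

theorem eventually_mem_baseSet (hf : MDifferentiableAt 𝓘(ℝ, E) 𝓘(ℝ, F) f p) :
    ∀ᶠ q in 𝓝 p, f q ∈ (trivializationAt F (TangentSpace 𝓘(ℝ, F)) (f p)).baseSet :=
  hf.continuousAt.eventually_mem
    ((trivializationAt F (TangentSpace 𝓘(ℝ, F)) (f p)).open_baseSet.mem_nhds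
    (FiberBundle.mem_baseSet_trivializationAt F _ (f p)))

theorem MDiffAlongAt.add_coord_eq (hf : MDifferentiableAt 𝓘(ℝ, E) 𝓘(ℝ, F) f p) :
    (fun q ↦ (trivializationAt F (TangentSpace 𝓘(ℝ, F)) (f p) ⟨f q, s q + s' q⟩).2) =ᶠ[𝓝 p]
    fun q ↦ (trivializationAt F (TangentSpace 𝓘(ℝ, F)) (f p) ⟨f q, s q⟩).2 +
      (trivializationAt F (TangentSpace 𝓘(ℝ, F)) (f p) ⟨f q, s' q⟩).2 := by
  filter_upwards [eventually_mem_baseSet hf] with q hq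
  exact ((trivializationAt F (TangentSpace 𝓘(ℝ, F)) (f p)).linear ℝ hq).map_add _ _

theorem MDiffAlongAt.smul_coord_eq (hf : MDifferentiableAt 𝓘(ℝ, E) 𝓘(ℝ, F) f p) (a : M → ℝ) :
    (fun q ↦ (trivializationAt F (TangentSpace 𝓘(ℝ, F)) (f p) ⟨f q, a q • s q⟩).2) =ᶠ[𝓝 p]
    fun q ↦ a q • (trivializationAt F (TangentSpace 𝓘(ℝ, F)) (f p) ⟨f q, s q⟩).2 := by
  filter_upwards [eventually_mem_baseSet hf] with q hq
  exact ((trivializationAt F (TangentSpace 𝓘(ℝ, F)) (f p)).linear ℝ hq).map_smul _ _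

theorem MDiffAlongAt.add (hs : MDiffAlongAt E f s p) (hs' : MDiffAlongAt E f s' p) :
    MDiffAlongAt E f (fun q ↦ s q + s' q) p := by
  rw [mdiffAlongAt_iff] at *
  exact ⟨hs.1, (hs.2.add hs'.2).congr_of_eventuallyEq (MDiffAlongAt.add_coord_eq hs.1)⟩

theorem MDiffAlongAt.smul {a : M → ℝ} (ha : MDiffAt a p) (hs : MDiffAlongAt E f s p) :
    MDiffAlongAt E f (fun q ↦ a q • s q) p := by
  rw [mdiffAlongAt_iff] at *
  exact ⟨hs.1, (ha.smul hs.2).congr_of_eventuallyEq (MDiffAlongAt.smul_coord_eq hs.1 a)⟩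

theorem MDiffAlongAt.sub (hs : MDiffAlongAt E f s p) (hs' : MDiffAlongAt E f s' p) :
    MDiffAlongAt E f (fun q ↦ s q - s' q) p := by
  have := hs.add (hs'.smul (a := fun _ ↦ -1) mdifferentiableAt_const)
  simpa [sub_eq_add_neg] using this

theorem MDiffAlongAt.congr (hs : MDiffAlongAt E f s p) (h : ∀ᶠ q in 𝓝 p, s' q = s q) :
    MDiffAlongAt E f s' p :=
  MDifferentiableAt.congr_of_eventuallyEq (f := fun q ↦ TotalSpace.mk' F (f q) (s q)) hs
    (by filter_upwards [h] with q hq; rw [hq])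

theorem mdiffAlongAt_comp {σ : VField F N} (hf : MDifferentiableAt 𝓘(ℝ, E) 𝓘(ℝ, F) f p)
    (hσ : MDiffAt (T% σ) (f p)) : MDiffAlongAt E f (fun q ↦ σ (f q)) p :=
  hσ.comp p hf

/-- The coordinate field on `N` with constant components `w` in the trivialization of the tangent
bundle at `y` is smooth at `y`. -/
theorem contMDiffAt_symmL (y : N) (w : F) :
    CMDiffAt ∞ (T% (fun z : N ↦ ((trivializationAt F (TangentSpace 𝓘(ℝ, F)) y).symmL ℝ z w :
      TangentSpace 𝓘(ℝ, F) z))) y := by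
  rw [contMDiffAt_section]
  refine (contMDiffAt_const (c := w)).congr_of_eventuallyEq ?_
  filter_upwards [(trivializationAt F (TangentSpace 𝓘(ℝ, F)) y).open_baseSet.mem_nhds
    (FiberBundle.mem_baseSet_trivializationAt F _ y)] with z hz
  rw [Trivialization.symmL_apply _ hz, Trivialization.apply_mk_symm _ hz]

/-- Fields along `f` are locally combinations, with functions on `M` as coefficients, of the
restrictions of fields on `N`. -/
theorem MDiffAlongAt.induction {P : (Π p : M, Tan F (f p)) → Prop}
    (comp : ∀ σ : VField F N, MDiffAt (T% σ) (f p) → P (fun q ↦ σ (f q)))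
    (add : ∀ s s', MDiffAlongAt E f s p → MDiffAlongAt E f s' p → P s → P s' →
      P (fun q ↦ s q + s' q))
    (smul : ∀ (a : M → ℝ) s, MDiffAt a p → MDiffAlongAt E f s p → P s → P (fun q ↦ a q • s q))
    (congr : ∀ s s', MDiffAlongAt E f s p → (∀ᶠ q in 𝓝 p, s' q = s q) → P s → P s')
    (hs : MDiffAlongAt E f s p) : P s := by
  have hf := (mdiffAlongAt_iff.1 hs).1
  let t := trivializationAt F (TangentSpace 𝓘(ℝ, F)) (f p)
  let b := Module.finBasis ℝ F
  let u : M → F := fun q ↦ (t ⟨f q, s q⟩).2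
  have hu : MDiffAt u p := (mdiffAlongAt_iff.1 hs).2
  let a : _ → M → ℝ := fun i q ↦ LinearMap.toContinuousLinearMap (b.coord i) (u q)
  have ha : ∀ i, MDiffAt (a i) p := fun i ↦
    ((LinearMap.toContinuousLinearMap (b.coord i)).hasFDerivAt
      (x := u p)).hasMFDerivAt.mdifferentiableAt.comp p hu
  let e : _ → VField F N := fun i z ↦ t.symmL ℝ z (b i)
  have he : ∀ i, MDiffAt (T% (e i)) (f p) := fun i ↦
    (contMDiffAt_symmL (f p) (b i)).mdifferentiableAt (by simp)
  have key : ∀ J : Finset _, MDiffAlongAt E f (fun q ↦ ∑ i ∈ J, a i q • e i (f q)) p ∧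
      P (fun q ↦ ∑ i ∈ J, a i q • e i (f q)) := by
    classical
    intro J
    induction J using Finset.induction_on with
    | empty =>
      have h0 : MDiffAt (T% (fun z : N ↦ (0 : TangentSpace 𝓘(ℝ, F) z))) (f p) :=
        mdifferentiableAt_zeroSection ..
      exact ⟨mdiffAlongAt_comp hf h0, comp _ h0⟩
    | insert i J hi ih =>
      have hi1 := mdiffAlongAt_comp hf (he i)
      have hi2 := smul _ _ (ha i) hi1 (comp _ (he i))
      simp only [Finset.sum_insert hi]
      exact ⟨(hi1.smul (ha i)).add ih.1, add _ _ (hi1.smul (ha i)) ih.1 hi2 ih.2⟩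
  refine congr _ _ (key Finset.univ).1 ?_ (key Finset.univ).2
  filter_upwards [eventually_mem_baseSet hf] with q hq
  have h1 : ∑ i, a i q • e i (f q) = t.symmL ℝ (f q) (u q) := by
    conv_rhs => rw [← b.sum_repr (u q)]
    rw [map_sum (t.symmL ℝ (f q))]
    simp [e, a]
  rw [h1, t.symmL_apply hq]
  exact (t.symm_apply_apply_mk hq (s q)).symm

variable (cov : Connection F N)

theorem cov_extend_add (y : N) (v v' : Tan F y) :
    cov (FiberBundle.extend F (v + v')) y =
      cov (FiberBundle.extend F v) y + cov (FiberBundle.extend F v') y := by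
  have hv := FiberBundle.mdifferentiableAt_extend (F := F) 𝓘(ℝ, F) v
  have hv' := FiberBundle.mdifferentiableAt_extend (F := F) 𝓘(ℝ, F) v'
  rw [← cov.isCovariantDerivativeOnUniv.add hv hv']
  refine cov.isCovariantDerivativeOnUniv.congr_of_eventuallyEq
    (FiberBundle.mdifferentiableAt_extend ..) (mdifferentiableAt_add_section hv hv')
    Filter.univ_mem ?_
  let t := trivializationAt F (TangentSpace 𝓘(ℝ, F)) y
  have hy := FiberBundle.mem_baseSet_trivializationAt F (TangentSpace 𝓘(ℝ, F)) y
  filter_upwards [t.open_baseSet.mem_nhds hy] with z hz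
  change t.symm z (t ⟨y, v + v'⟩).2 = t.symm z (t ⟨y, v⟩).2 + t.symm z (t ⟨y, v'⟩).2
  rw [(t.linear ℝ hy).map_add, ← t.symmL_apply (R := ℝ) hz, map_add, t.symmL_apply hz,
    t.symmL_apply hz]

theorem cov_extend_smul (y : N) (c : ℝ) (v : Tan F y) :
    cov (FiberBundle.extend F (c • v)) y = c • cov (FiberBundle.extend F v) y := by
  have hv := FiberBundle.mdifferentiableAt_extend (F := F) 𝓘(ℝ, F) v
  rw [← cov.isCovariantDerivativeOnUniv.smul_const c hv]
  refine cov.isCovariantDerivativeOnUniv.congr_of_eventuallyEq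
    (FiberBundle.mdifferentiableAt_extend ..) hv.smul_const_section
    Filter.univ_mem ?_
  let t := trivializationAt F (TangentSpace 𝓘(ℝ, F)) y
  have hy := FiberBundle.mem_baseSet_trivializationAt F (TangentSpace 𝓘(ℝ, F)) y
  filter_upwards [t.open_baseSet.mem_nhds hy] with z hz
  change t.symm z (t ⟨y, c • v⟩).2 = c • t.symm z (t ⟨y, v⟩).2
  rw [(t.linear ℝ hy).map_smul, ← t.symmL_apply (R := ℝ) hz, map_smul, t.symmL_apply hz]

theorem alongDeriv_add (hs : MDiffAlongAt E f s p) (hs' : MDiffAlongAt E f s' p) :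
    alongDeriv (E := E) cov f (fun q ↦ s q + s' q) p =
      alongDeriv cov f s p + alongDeriv cov f s' p := by
  rw [mdiffAlongAt_iff] at hs hs'
  have h1 : mvfderiv 𝓘(ℝ, E) (fun q ↦ (trivializationAt F (TangentSpace 𝓘(ℝ, F)) (f p)
      ⟨f q, s q + s' q⟩).2) p = mvfderiv 𝓘(ℝ, E) (fun q ↦
        (trivializationAt F (TangentSpace 𝓘(ℝ, F)) (f p) ⟨f q, s q⟩).2 +
        (trivializationAt F (TangentSpace 𝓘(ℝ, F)) (f p) ⟨f q, s' q⟩).2) p :=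
    (MDiffAlongAt.add_coord_eq hs.1).mfderiv_eq
  rw [alongDeriv, h1, mvfderiv_fun_add hs.2 hs'.2, cov_extend_add]
  simp only [alongDeriv, ContinuousLinearMap.comp_add, ContinuousLinearMap.add_comp]
  abel

theorem alongDeriv_smul {a : M → ℝ} (ha : MDiffAt a p) (hs : MDiffAlongAt E f s p) :
    alongDeriv cov f (fun q ↦ a q • s q) p =
      a p • alongDeriv cov f s p + (mvfderiv 𝓘(ℝ, E) a p).smulRight (s p) := by
  rw [mdiffAlongAt_iff] at hs
  have h1 : mvfderiv 𝓘(ℝ, E) (fun q ↦ (trivializationAt F (TangentSpace 𝓘(ℝ, F)) (f p)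
      ⟨f q, a q • s q⟩).2) p = mvfderiv 𝓘(ℝ, E) (fun q ↦
        a q • (trivializationAt F (TangentSpace 𝓘(ℝ, F)) (f p) ⟨f q, s q⟩).2) p :=
    (MDiffAlongAt.smul_coord_eq hs.1 a).mfderiv_eq
  have hy := FiberBundle.mem_baseSet_trivializationAt F (TangentSpace 𝓘(ℝ, F)) (f p)
  rw [alongDeriv, h1, mvfderiv_fun_smul ha hs.2, cov_extend_smul]
  ext v
  simp only [alongDeriv, add_apply, smul_apply, ContinuousLinearMap.comp_apply, smul_add,
    ContinuousLinearMap.smulRight_apply, map_add, map_smul]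
  have h2 : (trivializationAt F (TangentSpace 𝓘(ℝ, F)) (f p)).symmL ℝ (f p)
      (trivializationAt F (TangentSpace 𝓘(ℝ, F)) (f p) ⟨f p, s p⟩).2 = s p := by
    rw [Trivialization.symmL_apply _ hy]
    exact Trivialization.symm_apply_apply_mk _ hy (s p)
  rw [h2]
  abel

theorem alongDeriv_sub (hs : MDiffAlongAt E f s p) (hs' : MDiffAlongAt E f s' p) :
    alongDeriv (E := E) cov f (fun q ↦ s q - s' q) p =
      alongDeriv cov f s p - alongDeriv cov f s' p := by
  have h := alongDeriv_add cov (hs.sub hs') hs'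
  simp only [sub_add_cancel] at h
  exact eq_sub_of_add_eq h.symm

theorem alongDeriv_congr (h : ∀ᶠ q in 𝓝 p, s' q = s q) :
    alongDeriv (E := E) cov f s' p = alongDeriv cov f s p := by
  have h1 : mvfderiv 𝓘(ℝ, E) (fun q ↦ (trivializationAt F (TangentSpace 𝓘(ℝ, F)) (f p)
      ⟨f q, s' q⟩).2) p = mvfderiv 𝓘(ℝ, E) (fun q ↦
        (trivializationAt F (TangentSpace 𝓘(ℝ, F)) (f p) ⟨f q, s q⟩).2) p :=
    Filter.EventuallyEq.mfderiv_eq (by filter_upwards [h] with q hq; rw [hq])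
  rw [alongDeriv, alongDeriv, h1, h.self_of_nhds]

theorem MDiffAlongAt.mdifferentiableAt_inner (g : RiemMetric F N)
    (hs : MDiffAlongAt E f s p) (hs' : MDiffAlongAt E f s' p) :
    MDiffAt (fun q ↦ g.inner (f q) (s q) (s' q)) p := by
  let : RiemannianBundle (fun x : N ↦ Tan F x) := ⟨g.toRiemannianMetric⟩
  exact MDifferentiableAt.inner_bundle (IB := 𝓘(ℝ, F)) (F := F)
    (E := fun x : N ↦ Tan F x) (b := f) hs hs'

/-- The connection along `f` induced by a metric connection is metric. -/
theorem mvfderiv_inner_along {g : RiemMetric F N} {cov : Connection F N} (hcov : IsLeviCivita g cov)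
    (hs : MDiffAlongAt E f s p) (hs' : MDiffAlongAt E f s' p) (v : Tan E p) :
    mvfderiv 𝓘(ℝ, E) (fun q ↦ g.inner (f q) (s q) (s' q)) p v =
      g.inner (f p) (alongDeriv cov f s p v) (s' p) +
        g.inner (f p) (s p) (alongDeriv cov f s' p v) := by
  have hf := (mdiffAlongAt_iff.1 hs).1
  refine MDiffAlongAt.induction (P := fun s ↦ mvfderiv 𝓘(ℝ, E)
    (fun q ↦ g.inner (f q) (s q) (s' q)) p v = g.inner (f p) (alongDeriv cov f s p v) (s' p) +
      g.inner (f p) (s p) (alongDeriv cov f s' p v)) ?_ ?_ ?_ ?_ hs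
  · intro σ hσ
    have hσf := mdiffAlongAt_comp hf hσ
    refine MDiffAlongAt.induction (P := fun s' ↦ mvfderiv 𝓘(ℝ, E)
      (fun q ↦ g.inner (f q) (σ (f q)) (s' q)) p v =
        g.inner (f p) (alongDeriv cov f (fun q ↦ σ (f q)) p v) (s' p) +
        g.inner (f p) (σ (f p)) (alongDeriv cov f s' p v)) ?_ ?_ ?_ ?_ hs'
    · intro τ hτ
      rw [alongDeriv_comp cov hf hσ, alongDeriv_comp cov hf hτ]
      have h1 := mvfderiv_comp_apply p (g.mdifferentiableAt hσ hτ) hf v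
      exact h1.trans (hcov.metric _ hσ hτ)
    · intro t t' ht ht' ih ih'
      simp only [map_add]
      rw [mvfderiv_fun_add (hσf.mdifferentiableAt_inner g ht)
        (hσf.mdifferentiableAt_inner g ht'), alongDeriv_add cov ht ht']
      simp only [add_apply, map_add, ih, ih']
      ring
    · intro a t ha ht ih
      simp only [map_smul, smul_eq_mul]
      rw [mvfderiv_fun_mul ha (hσf.mdifferentiableAt_inner g ht), alongDeriv_smul cov ha ht]
      simp only [add_apply, smul_apply, map_add, map_smul, smul_eq_mul,
        ContinuousLinearMap.smulRight_apply, ih]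
      ring
    · intro t t' ht h ih
      rw [alongDeriv_congr (E := E) cov h, h.self_of_nhds, ← ih]
      have h1 : mvfderiv 𝓘(ℝ, E) (fun q ↦ g.inner (f q) (σ (f q)) (t' q)) p =
          mvfderiv 𝓘(ℝ, E) (fun q ↦ g.inner (f q) (σ (f q)) (t q)) p :=
        Filter.EventuallyEq.mfderiv_eq (by filter_upwards [h] with q hq; rw [hq])
      rw [h1]
  · intro t t' ht ht' ih ih'
    simp only [map_add, add_apply]
    rw [mvfderiv_fun_add (ht.mdifferentiableAt_inner g hs')
      (ht'.mdifferentiableAt_inner g hs'), alongDeriv_add cov ht ht']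
    simp only [add_apply, map_add, ih, ih']
    ring
  · intro a t ha ht ih
    simp only [map_smul, smul_apply, smul_eq_mul]
    rw [mvfderiv_fun_mul ha (ht.mdifferentiableAt_inner g hs'), alongDeriv_smul cov ha ht]
    simp only [add_apply, smul_apply, map_add, map_smul, smul_eq_mul,
      ContinuousLinearMap.smulRight_apply, ih]
    ring
  · intro t t' ht h ih
    rw [alongDeriv_congr (E := E) cov h, h.self_of_nhds, ← ih]
    have h1 : mvfderiv 𝓘(ℝ, E) (fun q ↦ g.inner (f q) (t' q) (s' q)) p =
        mvfderiv 𝓘(ℝ, E) (fun q ↦ g.inner (f q) (t q) (s' q)) p :=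
      Filter.EventuallyEq.mfderiv_eq (by filter_upwards [h] with q hq; rw [hq])
    rw [h1]

theorem MDiffAlongAt.almostComplex {g : RiemMetric F N} {φ : Π y : N, Tan F y →L[ℝ] Tan F y}
    (hφ : IsAlmostHermitian g φ) (hs : MDiffAlongAt E f s p) :
    MDiffAlongAt E f (fun q ↦ φ (f q) (s q)) p := by
  have hf := (mdiffAlongAt_iff.1 hs).1
  have h1 := ((hφ.smooth (f p)).mdifferentiableAt (by simp)).comp p hf
  exact MDifferentiableAt.clm_bundle_apply (b := f) h1 hs

/-- On a Kähler manifold, the connection along `f` commutes with the complex structure. -/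
theorem alongDeriv_almostComplex {g : RiemMetric F N} {φ : Π y : N, Tan F y →L[ℝ] Tan F y}
    (hφ : IsKahler g φ) (hs : MDiffAlongAt E f s p) (v : Tan E p) :
    alongDeriv (leviCivita g) f (fun q ↦ φ (f q) (s q)) p v =
      φ (f p) (alongDeriv (leviCivita g) f s p v) := by
  have hf := (mdiffAlongAt_iff.1 hs).1
  refine MDiffAlongAt.induction (P := fun s ↦
    alongDeriv (leviCivita g) f (fun q ↦ φ (f q) (s q)) p v =
      φ (f p) (alongDeriv (leviCivita g) f s p v)) ?_ ?_ ?_ ?_ hs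
  · intro σ hσ
    let τ : VField F N := fun z ↦ φ z (σ z)
    have hφσ : MDiffAt (T% τ) (f p) :=
      MDifferentiableAt.clm_bundle_apply (b := id)
        ((hφ.smooth (f p)).mdifferentiableAt (by simp)) hσ
    rw [alongDeriv_comp _ hf hσ, alongDeriv_comp (σ := τ) _ hf hφσ]
    exact hφ.parallel σ _ hσ _
  · intro t t' ht ht' ih ih'
    simp only [map_add]
    rw [alongDeriv_add _ ht ht', alongDeriv_add _ (ht.almostComplex hφ.toIsAlmostHermitian)
      (ht'.almostComplex hφ.toIsAlmostHermitian), add_apply, add_apply, ih, ih', map_add]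
  · intro a t ha ht ih
    simp only [map_smul]
    rw [alongDeriv_smul _ ha ht, alongDeriv_smul _ ha (ht.almostComplex hφ.toIsAlmostHermitian)]
    simp only [add_apply, smul_apply, map_add, map_smul, ih,
      ContinuousLinearMap.smulRight_apply]
  · intro t t' ht h ih
    rw [alongDeriv_congr (E := E) _ h, ← ih]
    rw [alongDeriv_congr]
    filter_upwards [h] with q hq
    rw [hq]

end Along

/-! ### The Lie bracket as a commutator of derivations -/

section Torsion

variable {E F : Type*} [NormedAddCommGroup E] [NormedSpace ℝ E] [FiniteDimensional ℝ E]
  [NormedAddCommGroup F] [NormedSpace ℝ F] [FiniteDimensional ℝ F]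
  {M N : Type*} [TopologicalSpace M] [ChartedSpace E M] [IsManifold 𝓘(ℝ, E) ∞ M]
  [TopologicalSpace N] [ChartedSpace F N] [IsManifold 𝓘(ℝ, F) ∞ N]
  {f : M → N} {X Y : VField E M} {p : M}

/-- The expression of a vector field in the chart at `p`. -/
noncomputable def chartField (E : Type*) [NormedAddCommGroup E] [NormedSpace ℝ E]
    {M : Type*} [TopologicalSpace M] [ChartedSpace E M] (X : VField E M) (p : M) : E → E :=
  mpullbackWithin 𝓘(ℝ, E) 𝓘(ℝ, E) (extChartAt 𝓘(ℝ, E) p).symm X (Set.range 𝓘(ℝ, E))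

theorem differentiableAt_chartField (hX : MDiffAt (T% X) p) :
    DifferentiableAt ℝ (chartField E X p) (extChartAt 𝓘(ℝ, E) p p) := by
  have : IsManifold 𝓘(ℝ, E) 2 M := IsManifold.of_le (n := ∞) ENat.LEInfty.out
  have h := MDifferentiableWithinAt.differentiableWithinAt_mpullbackWithin_vectorField
    (s := Set.univ) (mdifferentiableWithinAt_univ.2 hX)
  rw [← differentiableWithinAt_univ]
  exact h.mono (by simp)

theorem mfderiv_chart_symm_chartField {y : E} (hy : y ∈ (extChartAt 𝓘(ℝ, E) p).target) :
    (mfderiv 𝓘(ℝ, E) 𝓘(ℝ, E) (extChartAt 𝓘(ℝ, E) p).symm y : E →L[ℝ] E) (chartField E X p y) =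
      X ((extChartAt 𝓘(ℝ, E) p).symm y) := by
  have h := isInvertible_mfderivWithin_extChartAt_symm (I := 𝓘(ℝ, E)) hy
  have h2 := h.self_apply_inverse (X ((extChartAt 𝓘(ℝ, E) p).symm y))
  simp only [ModelWithCorners.range_eq_univ, mfderivWithin_univ] at h2
  unfold chartField
  simp only [ModelWithCorners.range_eq_univ]
  simp only [mpullbackWithin, mfderivWithin_univ]
  exact h2

theorem mfderiv_chart_apply :
    (mfderiv 𝓘(ℝ, E) 𝓘(ℝ, E) (extChartAt 𝓘(ℝ, E) p) p : E →L[ℝ] E) (X p) =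
      chartField E X p (extChartAt 𝓘(ℝ, E) p p) := by
  have hy := mem_extChartAt_target (I := 𝓘(ℝ, E)) p
  have h := congr($(mfderiv_extChartAt_comp_mfderivWithin_extChartAt_symm hy)
    (chartField E X p (extChartAt 𝓘(ℝ, E) p p)))
  simp only [ModelWithCorners.range_eq_univ, mfderivWithin_univ] at h
  have h2 : (mfderiv 𝓘(ℝ, E) 𝓘(ℝ, E) (extChartAt 𝓘(ℝ, E) p)
      ((extChartAt 𝓘(ℝ, E) p).symm (extChartAt 𝓘(ℝ, E) p p)) : E →L[ℝ] E)
      (X ((extChartAt 𝓘(ℝ, E) p).symm (extChartAt 𝓘(ℝ, E) p p))) =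
      chartField E X p (extChartAt 𝓘(ℝ, E) p p) :=
    (congrArg (mfderiv 𝓘(ℝ, E) 𝓘(ℝ, E) (extChartAt 𝓘(ℝ, E) p)
      ((extChartAt 𝓘(ℝ, E) p).symm (extChartAt 𝓘(ℝ, E) p p)) : E →L[ℝ] E)
      (mfderiv_chart_symm_chartField hy).symm).trans h
  have h3 := congrArg (fun q ↦ (mfderiv 𝓘(ℝ, E) 𝓘(ℝ, E) (extChartAt 𝓘(ℝ, E) p) q : E →L[ℝ] E) (X q))
    (extChartAt_to_inv (I := 𝓘(ℝ, E)) p)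
  exact h3.symm.trans h2

/-- Differentiation along a vector field, read in the chart. -/
theorem mvfderiv_eventuallyEq_chart {u : M → F} (hu : ContMDiffAt 𝓘(ℝ, E) 𝓘(ℝ, F) ∞ u p) :
    (fun q ↦ mvfderiv 𝓘(ℝ, E) u q (Y q)) =ᶠ[𝓝 p]
      (fun y ↦ fderiv ℝ (u ∘ (extChartAt 𝓘(ℝ, E) p).symm) y (chartField E Y p y)) ∘
        extChartAt 𝓘(ℝ, E) p := by
  have hu1 : ∀ᶠ q in 𝓝 p, MDiffAt u q := by
    have h1 : ContMDiffAt 𝓘(ℝ, E) 𝓘(ℝ, F) 1 u p := hu.of_le ENat.LEInfty.out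
    filter_upwards [(contMDiffAt_iff_contMDiffAt_nhds (by simp)).1 h1] with q hq
    exact hq.mdifferentiableAt one_ne_zero
  filter_upwards [hu1, extChartAt_source_mem_nhds (I := 𝓘(ℝ, E)) p] with q hq hqs
  have hy := (extChartAt 𝓘(ℝ, E) p).map_source hqs
  have hinv := (extChartAt 𝓘(ℝ, E) p).left_inv hqs
  have hψ : MDiffAt (extChartAt 𝓘(ℝ, E) p).symm (extChartAt 𝓘(ℝ, E) p q) := by
    have := mdifferentiableWithinAt_extChartAt_symm hy
    simpa only [ModelWithCorners.range_eq_univ, mdifferentiableWithinAt_univ] using this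
  have h1 := mfderiv_comp_apply (g := u) (I'' := 𝓘(ℝ, F)) _ (by rwa [hinv]) hψ
    (chartField E Y p (extChartAt 𝓘(ℝ, E) p q))
  have h2 := mfderiv_chart_symm_chartField (X := Y) hy
  have h3 := congrArg (fun q ↦ mvfderiv 𝓘(ℝ, E) u q (Y q)) hinv
  refine h3.symm.trans ?_
  simp only [← h2]
  refine h1.symm.trans ?_
  simp only [mfderiv_eq_fderiv]
  rfl

theorem mfderiv_chart_mlieBracket :
    (mfderiv 𝓘(ℝ, E) 𝓘(ℝ, E) (extChartAt 𝓘(ℝ, E) p) p : E →L[ℝ] E)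
        (mlieBracket 𝓘(ℝ, E) X Y p) =
      lieBracket ℝ (chartField E X p) (chartField E Y p) (extChartAt 𝓘(ℝ, E) p p) := by
  have h := isInvertible_mfderiv_extChartAt (I := 𝓘(ℝ, E)) (mem_extChartAt_source (I := 𝓘(ℝ, E)) p)
  let w : E := lieBracket ℝ (chartField E X p) (chartField E Y p) (extChartAt 𝓘(ℝ, E) p p)
  refine Eq.trans ?_ (h.self_apply_inverse w)
  rw [mlieBracket, mlieBracketWithin_apply]
  simp only [w]
  rw [← lieBracketWithin_univ]
  have : (extChartAt 𝓘(ℝ, E) p).symm ⁻¹' Set.univ ∩ Set.range 𝓘(ℝ, E) = Set.univ := by simp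
  rw [this]
  rfl

/-- The bracket is the commutator of the derivations given by the two vector fields, also on vector
valued functions. -/
theorem mvfderiv_mlieBracket {u : M → F} (hu : ContMDiffAt 𝓘(ℝ, E) 𝓘(ℝ, F) ∞ u p)
    (hX : MDiffAt (T% X) p) (hY : MDiffAt (T% Y) p) :
    mvfderiv 𝓘(ℝ, E) u p (mlieBracket 𝓘(ℝ, E) X Y p) =
      mvfderiv 𝓘(ℝ, E) (fun q ↦ mvfderiv 𝓘(ℝ, E) u q (Y q)) p (X p) -
        mvfderiv 𝓘(ℝ, E) (fun q ↦ mvfderiv 𝓘(ℝ, E) u q (X q)) p (Y p) := by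
  let ψ := (extChartAt 𝓘(ℝ, E) p).symm
  have hx : ContDiffAt ℝ ∞ (u ∘ ψ) (extChartAt 𝓘(ℝ, E) p p) := by
    have h := (contMDiffAt_iff.1 hu).2
    simpa [ψ] using! h
  have hφ : MDiffAt (extChartAt 𝓘(ℝ, E) p) p := mdifferentiableAt_extChartAt (mem_chart_source _ _)
  have key : ∀ {X Y : VField E M}, MDiffAt (T% X) p → MDiffAt (T% Y) p →
      mvfderiv 𝓘(ℝ, E) (fun q ↦ mvfderiv 𝓘(ℝ, E) u q (Y q)) p (X p) =
      fderiv ℝ (fun y ↦ fderiv ℝ (u ∘ ψ) y (chartField E Y p y)) (extChartAt 𝓘(ℝ, E) p p)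
        (chartField E X p (extChartAt 𝓘(ℝ, E) p p)) := by
    intro X Y hX hY
    have h1 := (mvfderiv_eventuallyEq_chart (Y := Y) hu).mfderiv_eq (I := 𝓘(ℝ, E)) (I' := 𝓘(ℝ, F))
    have hd : DifferentiableAt ℝ (fun y ↦ fderiv ℝ (u ∘ ψ) y (chartField E Y p y))
        (extChartAt 𝓘(ℝ, E) p p) :=
      ((hx.fderiv_right (m := 1) (by norm_cast)).differentiableAt one_ne_zero).clm_apply
        (differentiableAt_chartField hY)
    have h2 := mfderiv_comp_apply p hd.mdifferentiableAt hφ (X p)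
    rw [← mfderiv_chart_apply]
    rw [mfderiv_eq_fderiv] at h2
    exact congr($h1 (X p)).trans h2
  rw [key hX hY, key hY hX]
  have h4 := fderiv_apply_lieBracket (𝕜 := ℝ) hx (by simpa using ENat.LEInfty.out)
    (differentiableAt_chartField hY) (differentiableAt_chartField hX)
  refine Eq.trans ?_ h4
  rw [← mfderiv_chart_mlieBracket]
  have hu' : u =ᶠ[𝓝 p] (u ∘ ψ) ∘ extChartAt 𝓘(ℝ, E) p := by
    filter_upwards [extChartAt_source_mem_nhds (I := 𝓘(ℝ, E)) p] with q hqs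
    simp only [Function.comp, ψ, (extChartAt 𝓘(ℝ, E) p).left_inv hqs]
  have h5 := hu'.mfderiv_eq (I := 𝓘(ℝ, E)) (I' := 𝓘(ℝ, F))
  have hd : DifferentiableAt ℝ (u ∘ ψ) (extChartAt 𝓘(ℝ, E) p p) :=
    hx.differentiableAt (by simp)
  have h6 := mfderiv_comp_apply p hd.mdifferentiableAt hφ (mlieBracket 𝓘(ℝ, E) X Y p)
  rw [mfderiv_eq_fderiv] at h6
  exact congr($h5 (mlieBracket 𝓘(ℝ, E) X Y p)).trans h6

end Torsion

/-! ### Torsion of the connection along a map and the Gauss formula -/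

section Gauss

variable {E F : Type*} [NormedAddCommGroup E] [NormedSpace ℝ E] [FiniteDimensional ℝ E]
  [NormedAddCommGroup F] [NormedSpace ℝ F] [FiniteDimensional ℝ F]
  {M N : Type*} [TopologicalSpace M] [ChartedSpace E M] [IsManifold 𝓘(ℝ, E) ∞ M]
  [TopologicalSpace N] [ChartedSpace F N] [IsManifold 𝓘(ℝ, F) ∞ N]
  {f : M → N} {X Y : VField E M} {p : M}

theorem contMDiffAt_pushField (hf : ContMDiff 𝓘(ℝ, E) 𝓘(ℝ, F) ∞ f) (hY : CMDiffAt ∞ (T% Y) p) :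
    ContMDiffAt 𝓘(ℝ, E) (𝓘(ℝ, F).prod 𝓘(ℝ, F)) ∞
      (fun q ↦ TotalSpace.mk' F (E := TangentSpace 𝓘(ℝ, F)) (f q) (pushField f Y q)) p :=
  ((hf.contMDiff_tangentMap (m := ∞) (by simp)) _).comp p hY

theorem mdiffAlongAt_pushField (hf : ContMDiff 𝓘(ℝ, E) 𝓘(ℝ, F) ∞ f) (hY : MDiffAt (T% Y) p) :
    MDiffAlongAt E f (pushField (F := F) f Y) p :=
  ((hf.contMDiff_tangentMap (I := 𝓘(ℝ, E)) (I' := 𝓘(ℝ, F)) (m := ∞) (by simp)).mdifferentiable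
    (by simp) _).comp p hY

theorem trivializationAt_eq_mvfderiv {y z : N} (hz : z ∈ (chartAt F y).source) (v : Tan F z) :
    (trivializationAt F (TangentSpace 𝓘(ℝ, F)) y ⟨z, v⟩).2 =
      mvfderiv 𝓘(ℝ, F) (extChartAt 𝓘(ℝ, F) y) z v := by
  have h := congr($(TangentBundle.continuousLinearMapAt_trivializationAt (I := 𝓘(ℝ, F)) hz) v)
  rw [Trivialization.continuousLinearMapAt_apply, Trivialization.coe_linearMapAt_of_mem _ hz] at h
  exact h

/-- Coordinate vector fields commute. -/
theorem mlieBracket_extend (y : N) (v w : Tan F y) :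
    mlieBracket 𝓘(ℝ, F) (FiberBundle.extend F v) (FiberBundle.extend F w) y = 0 := by
  let t := trivializationAt F (TangentSpace 𝓘(ℝ, F)) y
  have hconst : ∀ v : Tan F y,
      (fun z ↦ mvfderiv 𝓘(ℝ, F) (extChartAt 𝓘(ℝ, F) y) z (FiberBundle.extend F v z)) =ᶠ[𝓝 y]
        fun _ ↦ (t ⟨y, v⟩).2 := by
    intro v
    -- near `y`, the field `extend v` has constant components in the chart
    filter_upwards [(chartAt F y).open_source.mem_nhds (mem_chart_source F y)] with z hz
    rw [← trivializationAt_eq_mvfderiv hz]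
    change (t ⟨z, t.symm z (t ⟨y, v⟩).2⟩).2 = (t ⟨y, v⟩).2
    rw [t.apply_mk_symm hz]
  have hzero : ∀ v : Tan F y, mvfderiv 𝓘(ℝ, F)
      (fun z ↦ mvfderiv 𝓘(ℝ, F) (extChartAt 𝓘(ℝ, F) y) z (FiberBundle.extend F v z)) y = 0 :=
    fun v ↦ ((hconst v).mfderiv_eq (I := 𝓘(ℝ, F)) (I' := 𝓘(ℝ, F))).trans mfderiv_const
  have h := mvfderiv_mlieBracket (u := extChartAt 𝓘(ℝ, F) y) (p := y) contMDiffAt_extChartAt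
    (FiberBundle.mdifferentiableAt_extend 𝓘(ℝ, F) F v)
    (FiberBundle.mdifferentiableAt_extend 𝓘(ℝ, F) F w)
  rw [hzero v, hzero w] at h
  have hinj := (isInvertible_mfderiv_extChartAt (I := 𝓘(ℝ, F))
    (mem_extChartAt_source (I := 𝓘(ℝ, F)) y)).injective
  apply hinj
  rw [map_zero]
  exact h.trans (sub_self (0 : F))

/-- The connection along `f` induced by a torsion-free connection is torsion-free. -/
theorem alongDeriv_pushField_sub {g : RiemMetric F N} {cov : Connection F N}
    (hcov : IsLeviCivita g cov)
    (hf : ContMDiff 𝓘(ℝ, E) 𝓘(ℝ, F) ∞ f) (hX : MDiffAt (T% X) p) (hY : MDiffAt (T% Y) p) :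
    alongDeriv cov f (pushField f Y) p (X p) - alongDeriv cov f (pushField f X) p (Y p) =
      mfderiv 𝓘(ℝ, E) 𝓘(ℝ, F) f p (mlieBracket 𝓘(ℝ, E) X Y p) := by
  let t := trivializationAt F (TangentSpace 𝓘(ℝ, F)) (f p)
  have hfp : MDiffAt f p := (hf p).mdifferentiableAt (by simp)
  have hu : ContMDiffAt 𝓘(ℝ, E) 𝓘(ℝ, F) ∞ (extChartAt 𝓘(ℝ, F) (f p) ∘ f) p :=
    contMDiffAt_extChartAt.comp p (hf p)
  have hcoord : ∀ Y : VField E M, mvfderiv 𝓘(ℝ, E) (fun q ↦ (t ⟨f q, pushField f Y q⟩).2) p =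
      mvfderiv 𝓘(ℝ, E)
        (fun q ↦ mvfderiv 𝓘(ℝ, E) (extChartAt 𝓘(ℝ, F) (f p) ∘ f) q (Y q)) p := by
    intro Y
    refine Filter.EventuallyEq.mfderiv_eq ?_
    filter_upwards [eventually_mem_baseSet hfp] with q hq
    rw [trivializationAt_eq_mvfderiv hq]
    exact (mfderiv_comp_apply (g := extChartAt 𝓘(ℝ, F) (f p)) (I'' := 𝓘(ℝ, F)) q
      (mdifferentiableAt_extChartAt hq) ((hf q).mdifferentiableAt (by simp)) (Y q)).symm
  have h1 := mvfderiv_mlieBracket hu hX hY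
  have h2 := hcov.torsion_free (FiberBundle.mdifferentiableAt_extend 𝓘(ℝ, F) F (pushField f X p))
    (FiberBundle.mdifferentiableAt_extend 𝓘(ℝ, F) F (pushField f Y p))
  rw [mlieBracket_extend, FiberBundle.extend_apply_self, FiberBundle.extend_apply_self] at h2
  have hy := FiberBundle.mem_baseSet_trivializationAt F (TangentSpace 𝓘(ℝ, F)) (f p)
  -- undoing the chart at `f p` turns the derivative of `f` read in the chart into that of `f`
  have h3 : ∀ w : Tan E p, t.symmL ℝ (f p)
      (mvfderiv 𝓘(ℝ, E) (extChartAt 𝓘(ℝ, F) (f p) ∘ f) p w) =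
        mfderiv 𝓘(ℝ, E) 𝓘(ℝ, F) f p w := by
    intro w
    have h4 := mfderiv_comp_apply (g := extChartAt 𝓘(ℝ, F) (f p)) (I'' := 𝓘(ℝ, F)) p
      (mdifferentiableAt_extChartAt (mem_chart_source F (f p))) hfp w
    have h5 := trivializationAt_eq_mvfderiv (mem_chart_source F (f p))
      (mfderiv 𝓘(ℝ, E) 𝓘(ℝ, F) f p w)
    have h6 : mvfderiv 𝓘(ℝ, E) (extChartAt 𝓘(ℝ, F) (f p) ∘ f) p w =
        (t ⟨f p, mfderiv 𝓘(ℝ, E) 𝓘(ℝ, F) f p w⟩).2 := h4.trans h5.symm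
    rw [h6, t.symmL_apply hy]
    exact t.symm_apply_apply_mk hy _
  rw [← h3, h1, map_sub, ← hcoord, ← hcoord]
  simp only [alongDeriv, add_apply, ContinuousLinearMap.comp_apply]
  change t.symmL ℝ (f p) _ + cov _ (f p) (pushField f X p) - (t.symmL ℝ (f p) _ +
    cov _ (f p) (pushField f Y p)) = _
  rw [add_sub_add_comm, h2, add_zero]

theorem inner_tangentPart (gM : RiemMetric E M) (g : RiemMetric F N) (w : Tan F (f p))
    (u : Tan E p) : gM.inner p (tangentPart gM g f p w) u =
      g.inner (f p) w (mfderiv 𝓘(ℝ, E) 𝓘(ℝ, F) f p u) := by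
  rw [tangentPart, gM.inner_flat_symm]
  rfl

/-- Gauss formula: the tangential component of the ambient derivative is the Levi-Civita derivative
of the induced metric. -/
theorem tangentPart_alongDeriv_pushField {gM : RiemMetric E M} {g : RiemMetric F N}
    (hf : IsSubmanifold gM g f) (hY : MDiffAt (T% Y) p) (v : Tan E p) :
    tangentPart gM g f p (alongDeriv (leviCivita g) f (pushField f Y) p v) =
      leviCivita gM Y p v := by
  have hLC := isLeviCivita_leviCivita g
  refine gM.ext_inner fun w ↦ ?_
  rw [inner_tangentPart]
  obtain ⟨X, hX, rfl⟩ : ∃ X : VField E M, MDiffAt (T% X) p ∧ X p = v :=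
    ⟨FiberBundle.extend E v, FiberBundle.mdifferentiableAt_extend .., by simp⟩
  obtain ⟨Z, hZ, rfl⟩ : ∃ Z : VField E M, MDiffAt (T% Z) p ∧ Z p = w :=
    ⟨FiberBundle.extend E w, FiberBundle.mdifferentiableAt_extend .., by simp⟩
  refine Eq.trans ?_ (inner_leviCivitaFun gM hX hY hZ).symm
  have push := fun {Y : VField E M} (hY : MDiffAt (T% Y) p) ↦ mdiffAlongAt_pushField hf.smooth hY
  have metric : ∀ {X Y Z : VField E M}, MDiffAt (T% Y) p → MDiffAt (T% Z) p →
      mvfderiv 𝓘(ℝ, E) (fun q ↦ gM.inner q (Y q) (Z q)) p (X p) =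
        g.inner (f p) (alongDeriv (leviCivita g) f (pushField f Y) p (X p)) (pushField f Z p) +
        g.inner (f p) (alongDeriv (leviCivita g) f (pushField f Z) p (X p)) (pushField f Y p) := by
    intro X Y Z hY hZ
    have h := mvfderiv_inner_along hLC (push hY) (push hZ) (X p)
    rw [g.symm _ (pushField f Y p)] at h
    simp only [hf.induced]
    exact h
  have torsion : ∀ {X Y : VField E M} (Z : VField E M), MDiffAt (T% X) p → MDiffAt (T% Y) p →
      gM.inner p (mlieBracket 𝓘(ℝ, E) X Y p) (Z p) =
        g.inner (f p) (alongDeriv (leviCivita g) f (pushField f Y) p (X p)) (pushField f Z p) -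
        g.inner (f p) (alongDeriv (leviCivita g) f (pushField f X) p (Y p)) (pushField f Z p) := by
    intro X Y Z hX hY
    rw [hf.induced, ← alongDeriv_pushField_sub hLC hf.smooth hX hY, map_sub, sub_apply]
    rfl
  rw [koszul, metric hY hZ, metric hX hZ, metric hX hY, torsion Z hX hY, torsion Y hX hZ,
    torsion X hY hZ]
  change g.inner (f p) _ (pushField f Z p) = _
  ring

end Gauss

/-! ### Smoothness of the tangential part and extension of sections -/

section Smoothness

variable {E F : Type*} [NormedAddCommGroup E] [NormedSpace ℝ E] [FiniteDimensional ℝ E]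
  [NormedAddCommGroup F] [NormedSpace ℝ F] [FiniteDimensional ℝ F]
  {M N : Type*} [TopologicalSpace M] [ChartedSpace E M] [IsManifold 𝓘(ℝ, E) ∞ M]
  [TopologicalSpace N] [ChartedSpace F N] [IsManifold 𝓘(ℝ, F) ∞ N]
  {f : M → N} {X Y : VField E M} {p : M}

theorem contMDiffAt_inner_along (g : RiemMetric F N) {s s' : Π q : M, Tan F (f q)}
    (hs : ContMDiffAt 𝓘(ℝ, E) (𝓘(ℝ, F).prod 𝓘(ℝ, F)) ∞
      (fun q ↦ TotalSpace.mk' F (E := TangentSpace 𝓘(ℝ, F)) (f q) (s q)) p)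
    (hs' : ContMDiffAt 𝓘(ℝ, E) (𝓘(ℝ, F).prod 𝓘(ℝ, F)) ∞
      (fun q ↦ TotalSpace.mk' F (E := TangentSpace 𝓘(ℝ, F)) (f q) (s' q)) p) :
    ContMDiffAt 𝓘(ℝ, E) 𝓘(ℝ, ℝ) ∞ (fun q ↦ g.inner (f q) (s q) (s' q)) p := by
  let : RiemannianBundle (fun x : N ↦ Tan F x) := ⟨g.toRiemannianMetric⟩
  exact ContMDiffAt.inner_bundle (IB := 𝓘(ℝ, F)) (F := F)
    (E := fun x : N ↦ Tan F x) (b := f) hs hs'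

/-- A vector field is smooth as soon as its inner products with smooth fields are smooth: its
components in a local frame are obtained from these by inverting the Gram matrix. -/
theorem contMDiffAt_of_inner (g : RiemMetric E M)
    (h : ∀ Z : VField E M, CMDiffAt ∞ (T% Z) p →
      ContMDiffAt 𝓘(ℝ, E) 𝓘(ℝ, ℝ) ∞ (fun q ↦ g.inner q (X q) (Z q)) p) :
    CMDiffAt ∞ (T% X) p := by
  let t := trivializationAt E (TangentSpace 𝓘(ℝ, E)) p
  have hp := FiberBundle.mem_baseSet_trivializationAt E (TangentSpace 𝓘(ℝ, E)) p
  let b := Module.finBasis ℝ E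
  let c := fun i ↦ LinearMap.toContinuousLinearMap (b.coord i)
  let e : _ → VField E M := fun i q ↦ t.symmL ℝ q (b i)
  have he : ∀ i, CMDiffAt ∞ (T% (e i)) p := fun i ↦ contMDiffAt_symmL p (b i)
  -- `L q` is the Gram matrix of the frame `e` at `q`
  let L : M → E →L[ℝ] E := fun q ↦ ∑ i, ∑ j, g.inner q (e i q) (e j q) • (c i).smulRight (b j)
  let y : M → E := fun q ↦ ∑ j, g.inner q (X q) (e j q) • b j
  have hL : ContMDiffAt 𝓘(ℝ, E) 𝓘(ℝ, E →L[ℝ] E) ∞ L p :=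
    ContMDiffAt.sum fun i _ ↦ ContMDiffAt.sum fun j _ ↦
      (contMDiffAt_inner_along (f := id) g (he i) (he j)).smul contMDiffAt_const
  have hy : ContMDiffAt 𝓘(ℝ, E) 𝓘(ℝ, E) ∞ y p :=
    ContMDiffAt.sum fun j _ ↦ (h _ (he j)).smul contMDiffAt_const
  have key : ∀ q (w : E), t.symmL ℝ q w = ∑ i, c i w • e i q := fun q w ↦ by
    conv_lhs => rw [← b.sum_repr w]
    rw [map_sum (t.symmL ℝ q)]
    simp [e, c]
  have hLapply : ∀ q (w : E), L q w = ∑ j, g.inner q (t.symmL ℝ q w) (e j q) • b j := fun q w ↦ by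
    simp only [L, key, sum_apply, smul_apply, map_sum,
      ContinuousLinearMap.smulRight_apply, map_smul, Finset.sum_smul, smul_eq_mul]
    rw [Finset.sum_comm]
    simp only [smul_smul, mul_comm]
  have hinv : ∀ q ∈ t.baseSet, (L q).IsInvertible := fun q hq ↦ by
    have hinj : Function.Injective (L q) := by
      rw [injective_iff_map_eq_zero]
      intro w hw
      rw [hLapply] at hw
      have h0 : ∀ j, g.inner q (t.symmL ℝ q w) (e j q) = 0 := fun j ↦
        Fintype.linearIndependent_iff.1 b.linearIndependent _ hw j
      have h1 : g.inner q (t.symmL ℝ q w) (t.symmL ℝ q w) = 0 := by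
        conv_lhs => rw [key q w, ← key q w]
        nth_rw 2 [key q w]
        simp [h0]
      have h2 : t.symmL ℝ q w = 0 := by
        by_contra hne
        exact (g.pos q _ hne).ne' h1
      have h3 := t.continuousLinearMapAt_symmL (R := ℝ) hq w
      rw [h2, map_zero] at h3
      exact h3.symm
    exact ⟨(LinearEquiv.ofInjectiveEndo (L q).toLinearMap hinj).toContinuousLinearEquiv, by
      ext; rfl⟩
  rw [contMDiffAt_section]
  have hx : (fun q ↦ (t ⟨q, X q⟩).2) =ᶠ[𝓝 p] fun q ↦ (L q).inverse (y q) := by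
    filter_upwards [t.open_baseSet.mem_nhds hp] with q hq
    have h1 : y q = L q (t ⟨q, X q⟩).2 := by
      rw [hLapply, t.symmL_apply hq]
      have := t.symm_apply_apply_mk hq (X q)
      simp only [this, y]
    rw [h1, (hinv q hq).inverse_apply_self]
  refine ContMDiffAt.congr_of_eventuallyEq ?_ hx
  obtain ⟨A, hA⟩ := hinv p hp
  have h2 : ContDiffAt ℝ ∞ (ContinuousLinearMap.inverse : (E →L[ℝ] E) → _) (L p) := by
    rw [← hA]
    exact contDiffAt_map_inverse A
  exact (h2.contMDiffAt.comp p hL).clm_apply hy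

/-- `TX` is smooth if `X` is. -/
theorem contMDiffAt_opT {gM : RiemMetric E M} {g : RiemMetric F N}
    {φ : Π y : N, Tan F y →L[ℝ] Tan F y} (hφ : IsAlmostHermitian g φ)
    (hf : IsSubmanifold gM g f) (hX : CMDiffAt ∞ (T% X) p) :
    CMDiffAt ∞ (T% (opT gM g φ f X)) p := by
  refine contMDiffAt_of_inner gM fun Z hZ ↦ ?_
  simp only [opT, inner_tangentPart]
  refine contMDiffAt_inner_along g ?_ (contMDiffAt_pushField hf.smooth hZ)
  exact ContMDiffAt.clm_bundle_apply (b := f)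
    ((hφ.smooth (f p)).comp p (hf.smooth p)) (contMDiffAt_pushField hf.smooth hX)

/-- Every vector of a smooth distribution extends to a global section, by means of a bump
function. -/
theorem exists_isSection_apply_eq [T2Space M] {D : Π p : M, Submodule ℝ (Tan E p)}
    (hD : IsSmoothDistribution D) {v : Tan E p} (hv : v ∈ D p) :
    ∃ Z : VField E M, IsSection D Z ∧ Z p = v := by
  obtain ⟨U, hU, hpU, r, X, hX, hspan⟩ := hD p
  rw [← (hspan p hpU).2] at hv
  obtain ⟨c, rfl⟩ := (Submodule.mem_span_range_iff_exists_fun ℝ).1 hv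
  obtain ⟨ρ, -, hρ⟩ := (SmoothBumpFunction.nhds_basis_tsupport (I := 𝓘(ℝ, E)) p).mem_iff.1
    (hU.mem_nhds hpU)
  have hW : CMDiff[U] ∞ (T% (fun q ↦ ∑ a, c a • X a q)) :=
    ContMDiffOn.sum_section fun a _ ↦ ContMDiffOn.const_smul_section (hX a)
  refine ⟨fun q ↦ ρ q • ∑ a, c a • X a q, ⟨?_, fun q ↦ ?_⟩, by simp⟩
  · exact ContMDiffOn.smul_section_of_tsupport ρ.contMDiff.contMDiffOn hU hρ hW
  · by_cases hq : q ∈ U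
    · refine Submodule.smul_mem _ _ ?_
      rw [← (hspan q hq).2]
      exact Submodule.sum_mem _ fun a _ ↦
        Submodule.smul_mem _ _ (Submodule.subset_span ⟨a, rfl⟩)
    · have h0 : ρ q = 0 := by
        by_contra hne
        exact hq (hρ (subset_tsupport _ hne))
      simp [h0]

theorem contMDiff_mlieBracket (hX : CMDiff ∞ (T% X)) (hY : CMDiff ∞ (T% Y)) :
    CMDiff ∞ (T% (mlieBracket 𝓘(ℝ, E) X Y)) := by
  have : IsManifold 𝓘(ℝ, E) ((⊤ : ℕ∞) + 1) M := inferInstanceAs (IsManifold 𝓘(ℝ, E) ∞ M)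
  have : IsManifold 𝓘(ℝ, E) (minSmoothness ℝ 2) M :=
    IsManifold.of_le (n := ∞) (by simpa using ENat.LEInfty.out)
  exact ContDiff.mlieBracket_vectorField (m := ⊤) (n := ⊤) hX hY (by simp)

end Smoothness

/-! ### Linear algebra of pointwise slant distributions -/

section SlantAlgebra

variable {E F : Type*} [NormedAddCommGroup E] [NormedSpace ℝ E] [FiniteDimensional ℝ E]
  [NormedAddCommGroup F] [NormedSpace ℝ F] [FiniteDimensional ℝ F]
  {M N : Type*} [TopologicalSpace M] [ChartedSpace E M] [IsManifold 𝓘(ℝ, E) ∞ M]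
  [TopologicalSpace N] [ChartedSpace F N] [IsManifold 𝓘(ℝ, F) ∞ N]
  {gM : RiemMetric E M} {g : RiemMetric F N} {φ : Π y : N, Tan F y →L[ℝ] Tan F y}
  {f : M → N} {p : M} {k : ℕ} {D : Fin (k + 1) → Π p : M, Submodule ℝ (Tan E p)}
  {θ : Fin (k + 1) → M → ℝ}

theorem RiemMetric.eq_zero_of_inner_self (g : RiemMetric E M) {v : Tan E p}
    (h : g.inner p v v = 0) : v = 0 := by
  by_contra hne
  exact (g.pos p v hne).ne' h

theorem tangentPart_add (w w' : Tan F (f p)) :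
    tangentPart gM g f p (w + w') = tangentPart gM g f p w + tangentPart gM g f p w' :=
  gM.ext_inner fun u ↦ by simp [inner_tangentPart]

theorem tangentPart_smul (c : ℝ) (w : Tan F (f p)) :
    tangentPart gM g f p (c • w) = c • tangentPart gM g f p w :=
  gM.ext_inner fun u ↦ by simp [inner_tangentPart]

theorem tangentPart_sub (w w' : Tan F (f p)) :
    tangentPart gM g f p (w - w') = tangentPart gM g f p w - tangentPart gM g f p w' :=
  gM.ext_inner fun u ↦ by simp [inner_tangentPart]

theorem normalPart_sub (w w' : Tan F (f p)) :
    normalPart gM g f p (w - w') = normalPart gM g f p w - normalPart gM g f p w' := by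
  rw [normalPart, normalPart, normalPart, tangentPart_sub, map_sub]
  abel

theorem tangentPart_mfderiv (hf : IsSubmanifold gM g f) (u : Tan E p) :
    tangentPart gM g f p (mfderiv 𝓘(ℝ, E) 𝓘(ℝ, F) f p u) = u :=
  gM.ext_inner fun w ↦ by rw [inner_tangentPart, hf.induced]

theorem normalPart_mfderiv (hf : IsSubmanifold gM g f) (u : Tan E p) :
    normalPart gM g f p (mfderiv 𝓘(ℝ, E) 𝓘(ℝ, F) f p u) = 0 := by
  rw [normalPart, tangentPart_mfderiv hf, sub_self]

variable (gM g φ f p) in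
/-- The endomorphism `T` of `T_p M`: the tangential part of `φ`. -/
noncomputable def tangentEnd : Tan E p →ₗ[ℝ] Tan E p where
  toFun v := tangentPart gM g f p (φ (f p) (mfderiv 𝓘(ℝ, E) 𝓘(ℝ, F) f p v))
  map_add' v w := by rw [map_add, map_add, tangentPart_add]
  map_smul' c v := by rw [map_smul, map_smul, tangentPart_smul]; rfl

theorem tangentEnd_apply (v : Tan E p) : tangentEnd gM g φ f p v =
    tangentPart gM g f p (φ (f p) (mfderiv 𝓘(ℝ, E) 𝓘(ℝ, F) f p v)) := rfl

theorem inner_tangentEnd (v w : Tan E p) : gM.inner p (tangentEnd gM g φ f p v) w =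
    g.inner (f p) (φ (f p) (mfderiv 𝓘(ℝ, E) 𝓘(ℝ, F) f p v)) (mfderiv 𝓘(ℝ, E) 𝓘(ℝ, F) f p w) :=
  inner_tangentPart ..

theorem bddBelow_angles (y : N) (w : Tan F y) (K : Submodule ℝ (Tan F y)) :
    BddBelow {α | ∃ u ∈ K, u ≠ 0 ∧
      α = Real.arccos (g.inner y w u / (√(g.inner y w w) * √(g.inner y u u)))} :=
  ⟨0, by rintro _ ⟨u, -, -, rfl⟩; exact Real.arccos_nonneg _⟩

theorem angleToSubspace_le_zero {y : N} {w : Tan F y} {K : Submodule ℝ (Tan F y)} (hw : w ∈ K)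
    (h0 : w ≠ 0) : angleToSubspace g y w K ≤ 0 := by
  refine csInf_le (bddBelow_angles y w K) ⟨w, hw, h0, ?_⟩
  rw [Real.mul_self_sqrt (g.pos y w h0).le, div_self (g.pos y w h0).ne', Real.arccos_one]

theorem angleToSubspace_of_orthogonal {y : N} {w u : Tan F y} {K : Submodule ℝ (Tan F y)}
    (hu : u ∈ K) (h0 : u ≠ 0) (h : ∀ u ∈ K, g.inner y w u = 0) :
    angleToSubspace g y w K = Real.pi / 2 := by
  have : {α | ∃ u ∈ K, u ≠ 0 ∧
      α = Real.arccos (g.inner y w u / (√(g.inner y w w) * √(g.inner y u u)))} =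
        {Real.pi / 2} := by
    ext α
    constructor
    · rintro ⟨u, hu, -, rfl⟩
      simp [h u hu]
    · rintro rfl
      exact ⟨u, hu, h0, by simp [h u hu]⟩
  rw [angleToSubspace, this, csInf_singleton]

namespace IsPointwiseSlant

variable (hM : IsPointwiseSlant gM g φ f k D θ)
include hM

theorem tangentEnd_mem {i : Fin (k + 1)} {v : Tan E p} (hv : v ∈ D i p) :
    tangentEnd gM g φ f p v ∈ D i p := by
  by_cases hi : i = 0
  · subst hi
    obtain ⟨w, hw, h⟩ := hM.invariant p v hv
    rw [tangentEnd_apply, h, tangentPart_mfderiv hM.toIsSubmanifold]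
    exact hw
  · exact hM.tangent_invariant i hi p v hv

theorem exists_components (v : Tan E p) :
    ∃ c : Fin (k + 1) → Tan E p, (∀ j, c j ∈ D j p) ∧ ∑ j, c j = v := by
  have hv : v ∈ ⨆ i, D i p := by rw [hM.sum_eq_top p]; trivial
  obtain ⟨c, hc, hsum⟩ := (Submodule.mem_iSup_iff_exists_finsupp _ _).1 hv
  refine ⟨c, hc, ?_⟩
  rw [← hsum, Finsupp.sum_fintype _ _ fun _ ↦ rfl]

theorem inner_sum_left {c : Fin (k + 1) → Tan E p} (hc : ∀ j, c j ∈ D j p) {j : Fin (k + 1)}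
    {w : Tan E p} (hw : w ∈ D j p) : gM.inner p (∑ l, c l) w = gM.inner p (c j) w := by
  rw [map_sum, sum_apply]
  exact Finset.sum_eq_single_of_mem j (Finset.mem_univ _)
    fun l _ hl ↦ hM.orthogonal l j hl p _ (hc l) _ hw

/-- `D i` is the orthogonal complement of the sum of the other distributions. -/
theorem mem_of_orthogonal {i : Fin (k + 1)} {v : Tan E p}
    (h : ∀ j, j ≠ i → ∀ w ∈ D j p, gM.inner p v w = 0) : v ∈ D i p := by
  obtain ⟨c, hc, rfl⟩ := hM.exists_components v
  refine Submodule.sum_mem _ fun j _ ↦ ?_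
  by_cases hj : j = i
  · exact hj ▸ hc j
  · have h1 := h j hj _ (hc j)
    rw [hM.inner_sum_left hc (hc j)] at h1
    rw [gM.eq_zero_of_inner_self h1]
    exact Submodule.zero_mem _

theorem mem_of_components {i : Fin (k + 1)} {c : Fin (k + 1) → Tan E p} (hc : ∀ j, c j ∈ D j p)
    (h : ∀ j, j ≠ i → c j = 0) : ∑ j, c j ∈ D i p := by
  refine Submodule.sum_mem _ fun j _ ↦ ?_
  by_cases hj : j = i
  · exact hj ▸ hc j
  · rw [h j hj]
    exact Submodule.zero_mem _

theorem mfderiv_mem_map {i : Fin (k + 1)} {v : Tan E p} (hv : v ∈ D i p) :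
    mfderiv 𝓘(ℝ, E) 𝓘(ℝ, F) f p v ∈ (D i p).map (mfderiv 𝓘(ℝ, E) 𝓘(ℝ, F) f p).toLinearMap :=
  ⟨v, hv, rfl⟩

theorem almostComplex_ne_zero (hφ : IsAlmostHermitian g φ) {v : Tan E p} (hv : v ≠ 0) :
    φ (f p) (mfderiv 𝓘(ℝ, E) 𝓘(ℝ, F) f p v) ≠ 0 := by
  intro h
  have h1 := hφ.isometry _ (mfderiv 𝓘(ℝ, E) 𝓘(ℝ, F) f p v) (mfderiv 𝓘(ℝ, E) 𝓘(ℝ, F) f p v)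
  rw [h, ← hM.induced] at h1
  exact (gM.pos p v hv).ne' (h1.symm.trans (by simp))

/-- `D 0` is the kernel of the normal part `N` of `φ`. Indeed, the components of `φ v` in the
different `D j` have orthogonal tangential and normal parts, so that `N v = 0` implies `N v_j = 0`
for all components `v_j` of `v`; for `j ≠ 0` and `v_j ≠ 0` the slant angle would be zero. -/
theorem normalPart_almostComplex_eq_zero_iff (hφ : IsAlmostHermitian g φ) {v : Tan E p} :
    normalPart gM g f p (φ (f p) (mfderiv 𝓘(ℝ, E) 𝓘(ℝ, F) f p v)) = 0 ↔ v ∈ D 0 p := by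
  constructor
  · intro h
    replace h : φ (f p) (mfderiv 𝓘(ℝ, E) 𝓘(ℝ, F) f p v) =
        mfderiv 𝓘(ℝ, E) 𝓘(ℝ, F) f p (tangentEnd gM g φ f p v) := sub_eq_zero.1 h
    obtain ⟨c, hc, rfl⟩ := hM.exists_components v
    refine hM.mem_of_components hc fun j hj ↦ ?_
    by_contra hne
    -- `φ (c j)` and `T (c j)` have the same length, so that `N (c j) = 0`
    have h1 : g.inner (f p) (φ (f p) (mfderiv 𝓘(ℝ, E) 𝓘(ℝ, F) f p (c j)))
        (φ (f p) (mfderiv 𝓘(ℝ, E) 𝓘(ℝ, F) f p (c j))) =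
          gM.inner p (tangentEnd gM g φ f p (c j)) (tangentEnd gM g φ f p (c j)) := by
      rw [hφ.isometry, ← hM.induced, ← hM.inner_sum_left hc (hc j), hM.induced, ← hφ.isometry, h,
        g.symm, ← inner_tangentEnd, gM.symm, map_sum,
        hM.inner_sum_left (fun l ↦ hM.tangentEnd_mem (hc l)) (hM.tangentEnd_mem (hc j))]
    have h2 : φ (f p) (mfderiv 𝓘(ℝ, E) 𝓘(ℝ, F) f p (c j)) =
        mfderiv 𝓘(ℝ, E) 𝓘(ℝ, F) f p (tangentEnd gM g φ f p (c j)) := by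
      rw [← sub_eq_zero]
      apply g.eq_zero_of_inner_self
      simp only [map_sub, sub_apply]
      rw [h1, ← inner_tangentEnd, g.symm (f p) (mfderiv 𝓘(ℝ, E) 𝓘(ℝ, F) f p _),
        ← inner_tangentEnd, ← hM.induced]
      ring
    obtain ⟨hθ, hslant⟩ := hM.slant j hj p
    rw [← hslant (c j) (hc j) hne] at hθ
    refine hθ.1.not_ge (angleToSubspace_le_zero ?_ (hM.almostComplex_ne_zero hφ hne))
    rw [h2]
    exact hM.mfderiv_mem_map (hM.tangentEnd_mem (hc j))
  · intro hv
    obtain ⟨w, -, h⟩ := hM.invariant p v hv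
    rw [h, normalPart_mfderiv hM.toIsSubmanifold]

theorem eq_zero_of_tangentEnd_eq_zero (hφ : IsAlmostHermitian g φ) {j : Fin (k + 1)}
    (hθ : θ j p ≠ Real.pi / 2) {v : Tan E p} (hv : v ∈ D j p)
    (h : tangentEnd gM g φ f p v = 0) : v = 0 := by
  by_contra hne
  by_cases hj : j = 0
  · subst hj
    obtain ⟨w, -, hw⟩ := hM.invariant p v hv
    rw [tangentEnd_apply, hw, tangentPart_mfderiv hM.toIsSubmanifold] at h
    refine hM.almostComplex_ne_zero hφ hne ?_
    rw [hw, h, map_zero]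
  · rw [← (hM.slant j hj p).2 v hv hne] at hθ
    refine hθ (angleToSubspace_of_orthogonal (hM.mfderiv_mem_map hv) ?_ ?_)
    · exact fun h0 ↦ hne (hM.immersion p (h0.trans (map_zero _).symm))
    · rintro _ ⟨u, -, rfl⟩
      refine (inner_tangentEnd (gM := gM) v u).symm.trans ?_
      rw [h]
      simp

/-- If none of the other distributions is anti-invariant at `p`, then `T` detects `D i`. -/
theorem tangentEnd_mem_iff (hφ : IsAlmostHermitian g φ) {i : Fin (k + 1)}
    (hθ : ∀ j, j ≠ i → θ j p ≠ Real.pi / 2) {v : Tan E p} :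
    tangentEnd gM g φ f p v ∈ D i p ↔ v ∈ D i p := by
  refine ⟨fun h ↦ ?_, hM.tangentEnd_mem⟩
  obtain ⟨c, hc, rfl⟩ := hM.exists_components v
  refine hM.mem_of_components hc fun j hj ↦
    hM.eq_zero_of_tangentEnd_eq_zero hφ (hθ j hj) (hc j) (gM.eq_zero_of_inner_self ?_)
  rw [← hM.inner_sum_left (fun l ↦ hM.tangentEnd_mem (hc l)) (hM.tangentEnd_mem (hc j)),
    ← map_sum]
  exact hM.orthogonal i j hj.symm p _ h _ (hM.tangentEnd_mem (hc j))

end IsPointwiseSlant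

end SlantAlgebra

/-! ### The bracket of two sections -/

section Integrability

variable {E F : Type*} [NormedAddCommGroup E] [NormedSpace ℝ E] [FiniteDimensional ℝ E]
  [NormedAddCommGroup F] [NormedSpace ℝ F] [FiniteDimensional ℝ F]
  {M N : Type*} [TopologicalSpace M] [ChartedSpace E M] [IsManifold 𝓘(ℝ, E) ∞ M]
  [TopologicalSpace N] [ChartedSpace F N] [IsManifold 𝓘(ℝ, F) ∞ N]
  {gM : RiemMetric E M} {g : RiemMetric F N} {φ : Π y : N, Tan F y →L[ℝ] Tan F y}
  {f : M → N} {p : M} {X Y Z : VField E M}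

theorem IsSection.mdifferentiableAt {D : Π p : M, Submodule ℝ (Tan E p)} (hX : IsSection D X) :
    MDiffAt (T% X) p :=
  (hX.1 p).mdifferentiableAt (by simp)

theorem isIntegrable_iff {D : Π p : M, Submodule ℝ (Tan E p)} :
    IsIntegrable D ↔ ∀ X Y : VField E M, IsSection D X → IsSection D Y →
      ∀ p, mlieBracket 𝓘(ℝ, E) X Y p ∈ D p :=
  ⟨fun h X Y hX hY ↦ (h X Y hX hY).2,
    fun h X Y hX hY ↦ ⟨contMDiff_mlieBracket hX.1 hY.1, h X Y hX hY⟩⟩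

/-- The component of `[X, Y]` in the direction of a field `Z` orthogonal to `X` and `Y`. -/
theorem inner_mlieBracket (hX : MDiffAt (T% X) p) (hY : MDiffAt (T% Y) p) (hZ : MDiffAt (T% Z) p)
    (hXZ : ∀ q, gM.inner q (X q) (Z q) = 0) (hYZ : ∀ q, gM.inner q (Y q) (Z q) = 0) :
    gM.inner p (mlieBracket 𝓘(ℝ, E) X Y p) (Z p) =
      gM.inner p (X p) (leviCivita gM Z p (Y p)) - gM.inner p (Y p) (leviCivita gM Z p (X p)) := by
  have hLC := isLeviCivita_leviCivita gM
  have h1 := hLC.metric (Y p) hX hZ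
  have h2 := hLC.metric (X p) hY hZ
  simp only [hXZ, hYZ] at h1 h2
  have h0 : ∀ v, mvfderiv 𝓘(ℝ, E) (fun _ : M ↦ (0 : ℝ)) p v = 0 := by simp [mvfderiv_const]
  rw [h0] at h1 h2
  rw [← hLC.torsion_free hX hY, map_sub, sub_apply]
  linarith

/-- On a submanifold of a Kähler manifold, the commutator of the ambient derivatives of `φ Y` and
`φ X` is `φ [X, Y]`. -/
theorem alongDeriv_almostComplex_sub (hN : IsKahler g φ) (hf : IsSubmanifold gM g f)
    (hX : MDiffAt (T% X) p) (hY : MDiffAt (T% Y) p) :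
    alongDeriv (leviCivita g) f (fun q ↦ φ (f q) (pushField f Y q)) p (X p) -
        alongDeriv (leviCivita g) f (fun q ↦ φ (f q) (pushField f X q)) p (Y p) =
      φ (f p) (mfderiv 𝓘(ℝ, E) 𝓘(ℝ, F) f p (mlieBracket 𝓘(ℝ, E) X Y p)) := by
  rw [alongDeriv_almostComplex hN (mdiffAlongAt_pushField hf.smooth hY),
    alongDeriv_almostComplex hN (mdiffAlongAt_pushField hf.smooth hX), ← map_sub,
    alongDeriv_pushField_sub (isLeviCivita_leviCivita g) hf.smooth hX hY]

theorem secondFundamentalForm_symm (hf : IsSubmanifold gM g f)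
    (hX : MDiffAt (T% X) p) (hY : MDiffAt (T% Y) p) :
    secondFundamentalForm gM g f X Y p = secondFundamentalForm gM g f Y X p := by
  rw [← sub_eq_zero, secondFundamentalForm, secondFundamentalForm, ← normalPart_sub,
    alongDeriv_pushField_sub (isLeviCivita_leviCivita g) hf.smooth hX hY, normalPart_mfderiv hf]

/-- For fields `X`, `Y` such that `φ X = TX` and `φ Y = TY` are tangent to the submanifold,
the normal part of `φ [X, Y]` is `h(X, TY) - h(TX, Y)`. -/
theorem secondFundamentalForm_opT_sub (hN : IsKahler g φ) (hf : IsSubmanifold gM g f)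
    (hX : CMDiffAt ∞ (T% X) p) (hY : CMDiffAt ∞ (T% Y) p)
    (hTX : ∀ q, normalPart gM g f q (φ (f q) (pushField f X q)) = 0)
    (hTY : ∀ q, normalPart gM g f q (φ (f q) (pushField f Y q)) = 0) :
    secondFundamentalForm gM g f X (opT gM g φ f Y) p -
        secondFundamentalForm gM g f (opT gM g φ f X) Y p =
      normalPart gM g f p
        (φ (f p) (mfderiv 𝓘(ℝ, E) 𝓘(ℝ, F) f p (mlieBracket 𝓘(ℝ, E) X Y p))) := by
  have hX' : pushField f (opT gM g φ f X) = fun q ↦ φ (f q) (pushField f X q) :=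
    funext fun q ↦ (sub_eq_zero.1 (hTX q)).symm
  have hY' : pushField f (opT gM g φ f Y) = fun q ↦ φ (f q) (pushField f Y q) :=
    funext fun q ↦ (sub_eq_zero.1 (hTY q)).symm
  rw [secondFundamentalForm_symm hf
    ((contMDiffAt_opT hN.toIsAlmostHermitian hf hX).mdifferentiableAt (by simp))
    (hY.mdifferentiableAt (by simp)), secondFundamentalForm, secondFundamentalForm, hX', hY',
    ← normalPart_sub, alongDeriv_almostComplex_sub hN hf (hX.mdifferentiableAt (by simp))
      (hY.mdifferentiableAt (by simp))]

/-- The tangential part of the ambient derivative of `φ Y`, by the Gauss and Weingarten formulas. -/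
theorem tangentPart_alongDeriv_almostComplex (hN : IsAlmostHermitian g φ)
    (hf : IsSubmanifold gM g f) (hY : CMDiffAt ∞ (T% Y) p) :
    tangentPart gM g f p
        (alongDeriv (leviCivita g) f (fun q ↦ φ (f q) (pushField f Y q)) p (X p)) =
      leviCivita gM (opT gM g φ f Y) p (X p) - shapeOperator gM g f (opN gM g φ f Y) X p := by
  have hT := (contMDiffAt_opT hN hf hY).mdifferentiableAt (by simp)
  have h1 : opN gM g φ f Y =
    fun q ↦ φ (f q) (pushField f Y q) - pushField f (opT gM g φ f Y) q := rfl
  rw [shapeOperator, sub_neg_eq_add, h1, alongDeriv_sub _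
    ((mdiffAlongAt_pushField hf.smooth (hY.mdifferentiableAt (by simp))).almostComplex hN)
    (mdiffAlongAt_pushField hf.smooth hT), sub_apply, tangentPart_sub,
    tangentPart_alongDeriv_pushField hf hT]
  abel

/-- On a submanifold of a Kähler manifold, `∇_X TY - ∇_Y TX + A_{NX} Y - A_{NY} X = T[X, Y]`. -/
theorem leviCivita_opT_sub_add_shapeOperator (hN : IsKahler g φ) (hf : IsSubmanifold gM g f)
    (hX : CMDiffAt ∞ (T% X) p) (hY : CMDiffAt ∞ (T% Y) p) :
    leviCivita gM (opT gM g φ f Y) p (X p) - leviCivita gM (opT gM g φ f X) p (Y p)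
        + shapeOperator gM g f (opN gM g φ f X) Y p
        - shapeOperator gM g f (opN gM g φ f Y) X p =
      opT gM g φ f (mlieBracket 𝓘(ℝ, E) X Y) p := by
  have h := alongDeriv_almostComplex_sub hN hf (hX.mdifferentiableAt (by simp))
    (hY.mdifferentiableAt (by simp))
  rw [opT, pushField, ← h, tangentPart_sub,
    tangentPart_alongDeriv_almostComplex hN.toIsAlmostHermitian hf hY,
    tangentPart_alongDeriv_almostComplex hN.toIsAlmostHermitian hf hX]
  abel

end Integrability

end KSlant

/-! ### Integrability criteria -/

open KSlant in
theorem theorem3p1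
    {E F : Type*} [NormedAddCommGroup E] [NormedSpace ℝ E] [FiniteDimensional ℝ E]
    [NormedAddCommGroup F] [NormedSpace ℝ F] [FiniteDimensional ℝ F]
    {M N : Type*}
    [TopologicalSpace M] [ChartedSpace E M] [IsManifold 𝓘(ℝ, E) ∞ M]
    [T2Space M] [SecondCountableTopology M]
    [TopologicalSpace N] [ChartedSpace F N] [IsManifold 𝓘(ℝ, F) ∞ N]
    [T2Space N] [SecondCountableTopology N]
    (g : RiemMetric F N) (φ : Π y : N, Tan F y →L[ℝ] Tan F y) (hN : IsKahler g φ)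
    (gM : RiemMetric E M) (f : M → N) (k : ℕ)
    (D : Fin (k + 1) → Π p : M, Submodule ℝ (Tan E p)) (θ : Fin (k + 1) → M → ℝ)
    (hM : IsPointwiseSlant gM g φ f k D θ) :
    -- (i)
    (∀ i, IsIntegrable (D i) ↔
      ∀ X Y : VField E M, IsSection (D i) X → IsSection (D i) Y →
        ∀ j, j ≠ i → ∀ Z : VField E M, IsSection (D j) Z → ∀ p,
          gM.inner p (X p) (leviCivita gM Z p (Y p)) =
            gM.inner p (Y p) (leviCivita gM Z p (X p))) ∧
    -- (ii)
    (IsIntegrable (D 0) ↔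
      ∀ X Y : VField E M, IsSection (D 0) X → IsSection (D 0) Y → ∀ p,
        secondFundamentalForm gM g f X (opT gM g φ f Y) p =
          secondFundamentalForm gM g f (opT gM g φ f X) Y p) ∧
    -- (iii)
    (∀ i, (∀ j, j ≠ i → ∀ p, θ j p ≠ Real.pi / 2) →
      (IsIntegrable (D i) ↔
        ∀ X Y : VField E M, IsSection (D i) X → IsSection (D i) Y →
          IsSection (D i) (fun p ↦
            leviCivita gM (opT gM g φ f Y) p (X p) - leviCivita gM (opT gM g φ f X) p (Y p)
              + shapeOperator gM g f (opN gM g φ f X) Y p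
              - shapeOperator gM g f (opN gM g φ f Y) X p))) := by
  have hH := hN.toIsAlmostHermitian
  have hf := hM.toIsSubmanifold
  refine ⟨fun i ↦ ?_, ?_, fun i hθ ↦ ?_⟩
  · rw [isIntegrable_iff]
    constructor
    · intro h X Y hX hY j hj Z hZ p
      have h1 := inner_mlieBracket (gM := gM) hX.mdifferentiableAt hY.mdifferentiableAt
        (hZ.mdifferentiableAt (p := p))
        (fun q ↦ hM.orthogonal i j hj.symm q _ (hX.2 q) _ (hZ.2 q))
        (fun q ↦ hM.orthogonal i j hj.symm q _ (hY.2 q) _ (hZ.2 q))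
      rw [hM.orthogonal i j hj.symm p _ (h X Y hX hY p) _ (hZ.2 p)] at h1
      linarith
    · intro h X Y hX hY p
      refine hM.mem_of_orthogonal fun j hj w hw ↦ ?_
      obtain ⟨Z, hZ, rfl⟩ := exists_isSection_apply_eq (hM.smooth_distribution j) hw
      rw [inner_mlieBracket (gM := gM) hX.mdifferentiableAt hY.mdifferentiableAt
        hZ.mdifferentiableAt (fun q ↦ hM.orthogonal i j hj.symm q _ (hX.2 q) _ (hZ.2 q))
        (fun q ↦ hM.orthogonal i j hj.symm q _ (hY.2 q) _ (hZ.2 q)),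
        h X Y hX hY j hj Z hZ p, sub_self]
  · rw [isIntegrable_iff]
    refine forall₄_congr fun X Y hX hY ↦ forall_congr' fun p ↦ ?_
    rw [← hM.normalPart_almostComplex_eq_zero_iff hH, ← sub_eq_zero (a := secondFundamentalForm ..),
      secondFundamentalForm_opT_sub hN hf (hX.1 p) (hY.1 p)
        (fun q ↦ (hM.normalPart_almostComplex_eq_zero_iff hH).2 (hX.2 q))
        (fun q ↦ (hM.normalPart_almostComplex_eq_zero_iff hH).2 (hY.2 q))]
  · rw [isIntegrable_iff]
    refine forall₄_congr fun X Y hX hY ↦ ?_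
    simp only [leviCivita_opT_sub_add_shapeOperator hN hf (hX.1 _) (hY.1 _)]
    have hT : CMDiff ∞ (T% (opT gM g φ f (mlieBracket 𝓘(ℝ, E) X Y))) := fun p ↦
      contMDiffAt_opT hH hf (contMDiff_mlieBracket hX.1 hY.1 p)
    refine Iff.trans ?_ (and_iff_right hT).symm
    exact forall_congr' fun p ↦ (hM.tangentEnd_mem_iff hH fun j hj ↦ hθ j hj p).symm
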